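/- Let $\Bbbk$ be a field, $S$ a finite set, $S^*$ the free monoid of words in $S$ and $\Bbbk\langle S\rangle$ the free algebra. A series is a map $\gamma:S^*\to\Bbbk$, extended linearly to $\Bbbk\langle S\rangle$. It is recognizable if $\gamma(w)=\mu\,\psi(w)\,\lambda$ for all words $w$, for some $n$, some algebra homomorphism $\psi:\Bbbk\langle S\rangle\to \mathrm{Mat}_n(\Bbbk)$, some row vector $\mu$ and some column vector $\lambda$; it is symmetric if $\gamma(uv)=\gamma(vu)$ for all words $u,v$. Put $$I^{\ell}_\gamma=\{x\mid \gamma(yx)=0\ \forall y\},\qquad I^{r}_\gamma=\{x\mid \gamma(xy)=0\ \forall y\},\qquad I_\gamma=\{x\mid \gamma(yxz)=0\ \forall y,z\}.$$ Let $\alpha=(\alpha^\bullet,\alpha^\circ)$ be a pair of recognizable series with $\alpha^\circ$ symmetric, let $I_\alpha=I_{\alpha^\bullet}\cap I_{\alpha^\circ}$ and $A_\alpha=\Bbbk\langle S\rangle/I_\alpha$. Let $\widetilde{\mathcal C}$ be the monoidal category whose objects are finite sequences of signs $\pm$ and whose morphisms $\underline\epsilon\to\underline\epsilon'$ are compact oriented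 one-manifolds $M$ with finitely many dots labelled by elements of $S$ in the interior and with $\partial M=\underline\epsilon'\sqcup(-\underline\epsilon)\sqcup\partial_{in}M$, where $\partial_{in}M$ is a finite set of floating endpoints, up to diffeomorphism rel the boundary $\underline\epsilon'\sqcup(-\underline\epsilon)$ that preserves the dots up to isotopy. Composition is gluing, and the tensor product is juxtaposition. Words along components are written from right to left as one follows the orientation. A component is floating if it has no endpoint in $\underline\epsilon\sqcup\underline\epsilon'$ (a circle, or an interval with two floating endpoints), and a cobordism is viewable if it has no floating components. The skein category $\mathcal S\widetilde{\mathcal C}_\alpha$ is the quotient of the $\Bbbk$-linearization of $\widetilde{\mathcal C}$ by the smallest tensor ideal that imposes the following relations: a floating interval with word $w$ equals $\alpha^\bullet(w)$; a floating circle with word $w$ equals $\alpha^\circ(w)$; every $u\in I_\alpha$ placed on the identity interval of $(+)$ is zero; every $u\in I^{\ell}_{\alpha^\bullet}$ placed on the interval from a floating endpoint to the top point $(+)$, a morphism $\emptyset\to(+)$, is zero; every $u\in I^{r}_{\alpha^\bullet}$ placed on the interval from the top point $(-)$ to a floating endpoint, a morphism $\emptyset\to(-)$, is zero. Let $B_\alpha,B^{\ell}_{\alpha^\bullet},B^{r}_{\alpha^\bullet}\subset\Bbbk\langle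 S\rangle$ be subsets that are mapped bijectively onto bases of the vector spaces $A_\alpha$, $\Bbbk\langle S\rangle/I^{\ell}_{\alpha^\bullet}$ and $I^{r}_{\alpha^\bullet}\backslash\Bbbk\langle S\rangle$, respectively. For sign sequences $\underline\epsilon,\underline\epsilon'$ let $B_\alpha(\underline\epsilon,\underline\epsilon')$ be the family of all viewable cobordisms without dots from $\underline\epsilon$ to $\underline\epsilon'$ (up to diffeomorphism rel boundary), together with all choices of - an element of $B_\alpha$ on each component without floating endpoints, - an element of $B^{\ell}_{\alpha^\bullet}$ on each component that has a floating endpoint and is oriented away from it, - an element of $B^{r}_{\alpha^\bullet}$ on each component that has a floating endpoint and is oriented towards it, where polynomials on components are expanded multilinearly into linear combinations of $S$-decorated cobordisms. Then $B_\alpha(\underline\epsilon,\underline\epsilon')$ is finite, and it is a basis of the vector space $\mathrm{Hom}_{\mathcal S\widetilde{\mathcal C}_\alpha}(\underline\epsilon,\underline\epsilon')$ (its members are in particular pairwise distinct there). Hence these hom spaces are finite-dimensional. -/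

import Mathlib

open scoped MonoidAlgebra

/-! ### Noncommutative series and their syntactic ideals -/

section Series

variable (K S : Type*) [Field K]

/-- The algebra `𝕜⟨S⟩` of noncommutative polynomials: the algebra of the free monoid of words. -/
abbrev NCPoly := MonoidAlgebra K (FreeMonoid S)

variable {K S}

/-- The linear extension of a noncommutative series (a function on words) to `𝕜⟨S⟩`. -/
noncomputable def seriesEval (a : FreeMonoid S → K) : NCPoly K S →ₗ[K] K :=
  (Finsupp.linearCombination K a).comp (MonoidAlgebra.coeffLinearEquiv K).toLinearMap

/-- `a` is recognizable: `a w = μ ψ(w) ξ` for a finite-dimensional matrix representation `ψ` of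
the algebra of noncommutative polynomials, a row vector `μ` and a column vector `ξ`. -/
def IsRecognizable (a : FreeMonoid S → K) : Prop :=
  ∃ (n : ℕ) (ψ : NCPoly K S →ₐ[K] Matrix (Fin n) (Fin n) K) (μ ξ : Fin n → K),
    ∀ w : FreeMonoid S, a w = μ ⬝ᵥ (ψ (MonoidAlgebra.single w 1)).mulVec ξ

/-- `a` is symmetric: it depends on a word only up to cyclic rotation. -/
def IsSymmetricSeries (a : FreeMonoid S → K) : Prop :=
  ∀ u v : FreeMonoid S, a (u * v) = a (v * u)

/-- The left syntactic ideal `{x | a (y x) = 0 for all y}`, as a subspace of `𝕜⟨S⟩`. -/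
noncomputable def leftSyntactic (a : FreeMonoid S → K) : Submodule K (NCPoly K S) :=
  ⨅ y : NCPoly K S, LinearMap.ker ((seriesEval a).comp (LinearMap.mulLeft K y))

/-- The right syntactic ideal `{x | a (x y) = 0 for all y}`, as a subspace of `𝕜⟨S⟩`. -/
noncomputable def rightSyntactic (a : FreeMonoid S → K) : Submodule K (NCPoly K S) :=
  ⨅ y : NCPoly K S, LinearMap.ker ((seriesEval a).comp (LinearMap.mulRight K y))

/-- The two-sided syntactic ideal `{x | a (y x z) = 0 for all y z}`, as a subspace of `𝕜⟨S⟩`. -/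
noncomputable def twoSidedSyntactic (a : FreeMonoid S → K) : Submodule K (NCPoly K S) :=
  ⨅ (y : NCPoly K S) (z : NCPoly K S), LinearMap.ker
    ((seriesEval a).comp ((LinearMap.mulRight K z).comp (LinearMap.mulLeft K y)))

/-- The syntactic ideal of a pair of series, the intersection of the two syntactic ideals.
The syntactic algebra of the pair is the quotient by it. -/
noncomputable def pairSyntactic (a c : FreeMonoid S → K) : Submodule K (NCPoly K S) :=
  twoSidedSyntactic a ⊓ twoSidedSyntactic c

/-- The set `B` is mapped bijectively onto a basis of the quotient space `V ⧸ I`. -/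
def DescendsToBasis {V : Type*} [AddCommGroup V] [Module K V] (I : Submodule K V)
    (B : Set V) : Prop :=
  LinearIndependent K (fun b : B => I.mkQ b) ∧ Submodule.span K (I.mkQ '' B) = ⊤

end Series

/-! ### Decorated one-dimensional cobordisms with floating endpoints -/

/-- A finite sequence of signs; `true` stands for `+` and `false` for `-`. -/
structure SignSeq where
  len : ℕ
  sign : Fin len → Bool

namespace SignSeq

/-- The empty sequence. -/
def empty : SignSeq := ⟨0, Fin.elim0⟩

/-- The sequence with one term. -/
def one (s : Bool) : SignSeq := ⟨1, fun _ => s⟩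

/-- Concatenation of sequences, the tensor product of objects. -/
def append (X Y : SignSeq) : SignSeq := ⟨X.len + Y.len, Fin.append X.sign Y.sign⟩

/-- The terms of the first sequence inside a concatenation. -/
def inLeft (X Y : SignSeq) (i : Fin X.len) : Fin (X.append Y).len := Fin.castAdd Y.len i

/-- The terms of the second sequence inside a concatenation. -/
def inRight (X Y : SignSeq) (i : Fin Y.len) : Fin (X.append Y).len := Fin.natAdd X.len i

@[simp] theorem sign_inLeft (X Y : SignSeq) (i : Fin X.len) :
    (X.append Y).sign (X.inLeft Y i) = X.sign i := Fin.append_left X.sign Y.sign i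

@[simp] theorem sign_inRight (X Y : SignSeq) (i : Fin Y.len) :
    (X.append Y).sign (X.inRight Y i) = Y.sign i := Fin.append_right X.sign Y.sign i

@[simp] theorem inLeft_inj (X Y : SignSeq) (i j : Fin X.len) :
    X.inLeft Y i = X.inLeft Y j ↔ i = j := (Fin.castAdd_injective X.len Y.len).eq_iff

@[simp] theorem inRight_inj (X Y : SignSeq) (i j : Fin Y.len) :
    X.inRight Y i = X.inRight Y j ↔ i = j := (Fin.natAdd_injective Y.len X.len).eq_iff

@[simp] theorem inLeft_ne_inRight (X Y : SignSeq) (i : Fin X.len) (j : Fin Y.len) :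
    X.inLeft Y i ≠ X.inRight Y j := by
  intro h
  have := congrArg Fin.val h
  simp only [inLeft, inRight, Fin.val_castAdd, Fin.val_natAdd] at this
  omega

@[simp] theorem inRight_ne_inLeft (X Y : SignSeq) (i : Fin X.len) (j : Fin Y.len) :
    X.inRight Y j ≠ X.inLeft Y i := (inLeft_ne_inRight X Y i j).symm

theorem inLeft_or_inRight (X Y : SignSeq) (i : Fin (X.append Y).len) :
    (∃ j, i = X.inLeft Y j) ∨ ∃ j, i = X.inRight Y j :=
  Fin.addCases (motive := fun i => (∃ j, i = X.inLeft Y j) ∨ ∃ j, i = X.inRight Y j)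
    (fun j => Or.inl ⟨j, rfl⟩) (fun j => Or.inr ⟨j, rfl⟩) i

end SignSeq

/-- A connected component of a decorated oriented one-manifold, up to diffeomorphism, whose
non-floating endpoints carry labels in `L`. An oriented interval `arc s t w` starts at `s` and ends
at `t`, where `none` stands for a floating endpoint, and `w` is the word of its dots, written
from right to left as one follows the orientation. A circle carries a word up to cyclic rotation. -/
inductive Strand (S L : Type*) where
  | arc (s t : Option L) (w : FreeMonoid S)
  | circle (w : Cycle S)

namespace Strand

variable {S L L' : Type*}

/-- The label of the starting point, if there is one. -/
def src : Strand S L → Option L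
  | arc s _ _ => s
  | circle _ => none

/-- The label of the end point, if there is one. -/
def tgt : Strand S L → Option L
  | arc _ t _ => t
  | circle _ => none

/-- The word of an interval. -/
def word : Strand S L → FreeMonoid S
  | arc _ _ w => w
  | circle _ => 1

/-- Change of labels. -/
def relabel (f : L → Option L') : Strand S L → Strand S L'
  | arc s t w => arc (s.bind f) (t.bind f) w
  | circle w => circle w

/-- The interval that follows `p` first and then `q`. -/
def join (p q : Strand S L) : Strand S L := arc p.src q.tgt (q.word * p.word)

/-- The circle obtained from an interval by gluing its end to its start. -/
def close (p : Strand S L) : Strand S L := circle (p.word.toList : Cycle S)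

@[simp] theorem join_src (p q : Strand S L) : (p.join q).src = p.src := rfl

@[simp] theorem join_tgt (p q : Strand S L) : (p.join q).tgt = q.tgt := rfl

@[simp] theorem close_src (p : Strand S L) : p.close.src = none := rfl

@[simp] theorem close_tgt (p : Strand S L) : p.close.tgt = none := rfl

end Strand

/-- Glue the end labelled `z` to the start labelled `z`, in a collection of components in which
the label `z` occurs exactly once at an end and exactly once at a start: if these belong to one
interval, it becomes a circle; if they belong to two intervals, these are joined. -/
def glue {S L : Type*} [DecidableEq L] (z : L) (D : Multiset (Strand S L)) :
    Multiset (Strand S L) :=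
  D.filter (fun p => p.src ≠ some z ∧ p.tgt ≠ some z)
  + (D.filter (fun p => p.src = some z ∧ p.tgt = some z)).map Strand.close
  + ((D.filter (fun p => p.src ≠ some z ∧ p.tgt = some z)) ×ˢ
      (D.filter (fun p => p.src = some z ∧ p.tgt ≠ some z))).map (fun pq => pq.1.join pq.2)

/-- The boundary points of a cobordism from `X` (bottom) to `Y` (top). -/
abbrev BdPt (X Y : SignSeq) := Fin X.len ⊕ Fin Y.len

/-- The boundary points at which a component starts: the bottom points with sign `+` and the
top points with sign `-`. At the other boundary points a component ends. -/
def isStart (X Y : SignSeq) : BdPt X Y → Bool :=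
  Sum.elim X.sign (fun j => !Y.sign j)

/-- An `S`-decorated oriented one-dimensional cobordism from `X` to `Y`, possibly with floating
endpoints, up to diffeomorphism rel boundary: a finite collection of components such that each
boundary point is the endpoint of exactly one component, with the right orientation. -/
@[ext] structure Cob (S : Type*) (X Y : SignSeq) where
  strands : Multiset (Strand S (BdPt X Y))
  starts : ∀ b, strands.countP (fun p => p.src = some b) = if isStart X Y b then 1 else 0
  ends : ∀ b, strands.countP (fun p => p.tgt = some b) = if isStart X Y b then 0 else 1

section Counting

variable {S L L' : Type*}

theorem countP_src_cons [DecidableEq L] (b : L) (p : Strand S L) (D : Multiset (Strand S L)) :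
    (p ::ₘ D).countP (fun p => p.src = some b) =
      D.countP (fun p => p.src = some b) + if p.src = some b then 1 else 0 :=
  Multiset.countP_cons _ _ _

theorem countP_tgt_cons [DecidableEq L] (b : L) (p : Strand S L) (D : Multiset (Strand S L)) :
    (p ::ₘ D).countP (fun p => p.tgt = some b) =
      D.countP (fun p => p.tgt = some b) + if p.tgt = some b then 1 else 0 :=
  Multiset.countP_cons _ _ _

/-- The two possible shapes of a collection of components in which `z` occurs once at a start and
once at an end. -/
theorem exists_gluing_shape [DecidableEq L] (z : L) (D : Multiset (Strand S L))
    (h1 : D.countP (fun p => p.src = some z) = 1) (h2 : D.countP (fun p => p.tgt = some z) = 1) :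
    ∃ R : Multiset (Strand S L), (∀ p ∈ R, p.src ≠ some z ∧ p.tgt ≠ some z) ∧
      ((∃ p, p.src = some z ∧ p.tgt = some z ∧ D = p ::ₘ R) ∨
        (∃ p q, p.src ≠ some z ∧ p.tgt = some z ∧ q.src = some z ∧ q.tgt ≠ some z ∧
          D = p ::ₘ q ::ₘ R)) := by
  obtain ⟨p, hp, hpz⟩ := Multiset.countP_pos.1 (h2.symm ▸ one_pos)
  obtain ⟨D', rfl⟩ := Multiset.exists_cons_of_mem hp
  rw [countP_tgt_cons, if_pos hpz] at h2
  have h2' := Multiset.countP_eq_zero.1 (Nat.succ_injective h2)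
  rw [countP_src_cons] at h1
  by_cases hs : p.src = some z
  · rw [if_pos hs] at h1
    have h1' := Multiset.countP_eq_zero.1 (Nat.succ_injective h1)
    exact ⟨D', fun r hr => ⟨h1' r hr, h2' r hr⟩, Or.inl ⟨p, hs, hpz, rfl⟩⟩
  · rw [if_neg hs, add_zero] at h1
    obtain ⟨q, hq, hqz⟩ := Multiset.countP_pos.1 (h1.symm ▸ one_pos)
    obtain ⟨R, rfl⟩ := Multiset.exists_cons_of_mem hq
    rw [countP_src_cons, if_pos hqz] at h1
    have h1' := Multiset.countP_eq_zero.1 (Nat.succ_injective h1)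
    exact ⟨R, fun r hr => ⟨h1' r hr, h2' r (Multiset.mem_cons_of_mem hr)⟩,
      Or.inr ⟨p, q, hs, hpz, hqz, h2' q hq, rfl⟩⟩

theorem glue_eq_close [DecidableEq L] (z : L) (R : Multiset (Strand S L))
    (hR : ∀ p ∈ R, p.src ≠ some z ∧ p.tgt ≠ some z) (p : Strand S L)
    (h1 : p.src = some z) (h2 : p.tgt = some z) : glue z (p ::ₘ R) = p.close ::ₘ R := by
  have e1 : R.filter (fun p => p.src ≠ some z ∧ p.tgt ≠ some z) = R :=
    Multiset.filter_eq_self.2 hR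
  have e2 : R.filter (fun p => p.src = some z ∧ p.tgt = some z) = 0 :=
    Multiset.filter_eq_nil.2 fun r hr h => (hR r hr).1 h.1
  have e3 : R.filter (fun p => p.src ≠ some z ∧ p.tgt = some z) = 0 :=
    Multiset.filter_eq_nil.2 fun r hr h => (hR r hr).2 h.2
  simp [glue, h1, h2, e1, e2, e3]
  simp [← Multiset.singleton_add, add_comm]

theorem glue_eq_join [DecidableEq L] (z : L) (R : Multiset (Strand S L))
    (hR : ∀ p ∈ R, p.src ≠ some z ∧ p.tgt ≠ some z) (p q : Strand S L)
    (h1 : p.src ≠ some z) (h2 : p.tgt = some z) (h3 : q.src = some z) (h4 : q.tgt ≠ some z) :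
    glue z (p ::ₘ q ::ₘ R) = p.join q ::ₘ R := by
  have e1 : R.filter (fun p => p.src ≠ some z ∧ p.tgt ≠ some z) = R :=
    Multiset.filter_eq_self.2 hR
  have e2 : R.filter (fun p => p.src = some z ∧ p.tgt = some z) = 0 :=
    Multiset.filter_eq_nil.2 fun r hr h => (hR r hr).1 h.1
  have e3 : R.filter (fun p => p.src ≠ some z ∧ p.tgt = some z) = 0 :=
    Multiset.filter_eq_nil.2 fun r hr h => (hR r hr).2 h.2
  have e4 : R.filter (fun p => p.src = some z ∧ p.tgt ≠ some z) = 0 :=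
    Multiset.filter_eq_nil.2 fun r hr h => (hR r hr).1 h.1
  simp only [glue, Multiset.filter_cons, h1, h2, h3, h4, e1, e2, e3, e4]
  simp [← Multiset.singleton_add, add_comm, if_neg h1, if_neg h4]

theorem countP_glue [DecidableEq L] (z : L) (D : Multiset (Strand S L))
    (h1 : D.countP (fun p => p.src = some z) = 1) (h2 : D.countP (fun p => p.tgt = some z) = 1)
    (b : L) :
    (glue z D).countP (fun p => p.src = some b) =
        (if b = z then 0 else D.countP (fun p => p.src = some b)) ∧
      (glue z D).countP (fun p => p.tgt = some b) =
        (if b = z then 0 else D.countP (fun p => p.tgt = some b)) := by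
  obtain ⟨R, hR, ⟨p, hp1, hp2, rfl⟩ | ⟨p, q, hp1, hp2, hq1, hq2, rfl⟩⟩ :=
    exists_gluing_shape z D h1 h2
  · rw [glue_eq_close z R hR p hp1 hp2]
    simp only [countP_src_cons, countP_tgt_cons, Strand.close_src, Strand.close_tgt, hp1, hp2]
    by_cases hb : b = z
    · subst hb
      rw [if_pos rfl, if_pos rfl]
      exact ⟨Multiset.countP_eq_zero.2 fun r hr => (hR r hr).1,
        Multiset.countP_eq_zero.2 fun r hr => (hR r hr).2⟩
    · simp [hb, Ne.symm hb]
  · rw [glue_eq_join z R hR p q hp1 hp2 hq1 hq2]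
    by_cases hb : b = z
    · subst hb
      rw [if_pos rfl, if_pos rfl, Multiset.countP_eq_zero, Multiset.countP_eq_zero]
      exact ⟨Multiset.forall_mem_cons.2 ⟨hp1, fun r hr => (hR r hr).1⟩,
        Multiset.forall_mem_cons.2 ⟨hq2, fun r hr => (hR r hr).2⟩⟩
    · simp only [countP_src_cons, countP_tgt_cons, hp2, hq1]
      simp only [hb, Ne.symm hb, Option.some.injEq, if_false, add_zero]
      exact ⟨rfl, rfl⟩

theorem countP_foldr_glue [DecidableEq L] (D : Multiset (Strand S L)) (l : List L) (hl : l.Nodup)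
    (h1 : ∀ z ∈ l, D.countP (fun p => p.src = some z) = 1)
    (h2 : ∀ z ∈ l, D.countP (fun p => p.tgt = some z) = 1) (b : L) :
    (l.foldr glue D).countP (fun p => p.src = some b) =
        (if b ∈ l then 0 else D.countP (fun p => p.src = some b)) ∧
      (l.foldr glue D).countP (fun p => p.tgt = some b) =
        (if b ∈ l then 0 else D.countP (fun p => p.tgt = some b)) := by
  induction l generalizing b with
  | nil => simp
  | cons z l ih =>
    rw [List.nodup_cons] at hl
    have ih' := ih hl.2 (fun y hy => h1 y (List.mem_cons_of_mem _ hy))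
      (fun y hy => h2 y (List.mem_cons_of_mem _ hy))
    have hz := ih' z
    rw [if_neg hl.1, if_neg hl.1, h1 z List.mem_cons_self, h2 z List.mem_cons_self] at hz
    have hg := countP_glue z _ hz.1 hz.2 b
    rw [List.foldr_cons, hg.1, hg.2, (ih' b).1, (ih' b).2]
    by_cases hb : b = z <;> simp [hb]

theorem countP_relabel [DecidableEq L] [DecidableEq L'] (f : L → Option L') (D : Multiset (Strand S L)) (b : L') (a : L)
    (h : ∀ l, f l = some b ↔ l = a) :
    (D.map (Strand.relabel f)).countP (fun p => p.src = some b) =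
        D.countP (fun p => p.src = some a) ∧
      (D.map (Strand.relabel f)).countP (fun p => p.tgt = some b) =
        D.countP (fun p => p.tgt = some a) := by
  rw [Multiset.countP_map, Multiset.countP_map, ← Multiset.countP_eq_card_filter,
    ← Multiset.countP_eq_card_filter]
  constructor <;> refine Multiset.countP_congr rfl fun p _ => ?_ <;>
    cases p <;> simp [Strand.relabel, Strand.src, Strand.tgt, Option.bind_eq_some_iff, h]

theorem countP_relabel_eq_zero [DecidableEq L'] (f : L → Option L') (D : Multiset (Strand S L)) (b : L')
    (h : ∀ l, f l ≠ some b) :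
    (D.map (Strand.relabel f)).countP (fun p => p.src = some b) = 0 ∧
      (D.map (Strand.relabel f)).countP (fun p => p.tgt = some b) = 0 := by
  rw [Multiset.countP_eq_zero, Multiset.countP_eq_zero]
  constructor <;> intro p hp <;> obtain ⟨q, -, rfl⟩ := Multiset.mem_map.1 hp <;>
    cases q <;> simp [Strand.relabel, Strand.src, Strand.tgt, Option.bind_eq_some_iff, h]

end Counting

namespace Cob

variable {S : Type*} {X Y Z X' Y' : SignSeq}

/-- Labels for the gluing of cobordisms from `X` to `Y` and from `Y` to `Z`: the labels of the
lower cobordism. -/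
def lowerLabel (X Y Z : SignSeq) : BdPt X Y → Option (Fin X.len ⊕ Fin Y.len ⊕ Fin Z.len)
  | .inl i => some (.inl i)
  | .inr j => some (.inr (.inl j))

/-- The labels of the upper cobordism. -/
def upperLabel (X Y Z : SignSeq) : BdPt Y Z → Option (Fin X.len ⊕ Fin Y.len ⊕ Fin Z.len)
  | .inl j => some (.inr (.inl j))
  | .inr k => some (.inr (.inr k))

/-- The labels that remain after gluing. The middle labels no longer occur then. -/
def outerLabel (X Y Z : SignSeq) : Fin X.len ⊕ Fin Y.len ⊕ Fin Z.len → Option (BdPt X Z)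
  | .inl i => some (.inl i)
  | .inr (.inl _) => none
  | .inr (.inr k) => some (.inr k)

/-- The disjoint union of two cobordisms that are about to be glued along `Y`. Each point of `Y`
occurs as the end of one component and as the start of one component. -/
def stack (M : Cob S X Y) (N : Cob S Y Z) :
    Multiset (Strand S (Fin X.len ⊕ Fin Y.len ⊕ Fin Z.len)) :=
  M.strands.map (Strand.relabel (lowerLabel X Y Z)) +
    N.strands.map (Strand.relabel (upperLabel X Y Z))

/-- The points of `Y` as middle labels. -/
def middle (X Y Z : SignSeq) : List (Fin X.len ⊕ Fin Y.len ⊕ Fin Z.len) :=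
  (List.finRange Y.len).map (fun j => .inr (.inl j))

theorem countP_stack (M : Cob S X Y) (N : Cob S Y Z) :
    (∀ i, (stack M N).countP (fun p => p.src = some (.inl i)) = (if X.sign i then 1 else 0) ∧
      (stack M N).countP (fun p => p.tgt = some (.inl i)) = (if X.sign i then 0 else 1)) ∧
    (∀ j, (stack M N).countP (fun p => p.src = some (.inr (.inl j))) = 1 ∧
      (stack M N).countP (fun p => p.tgt = some (.inr (.inl j))) = 1) ∧
    (∀ k, (stack M N).countP (fun p => p.src = some (.inr (.inr k))) =
        (if Z.sign k then 0 else 1) ∧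
      (stack M N).countP (fun p => p.tgt = some (.inr (.inr k))) =
        (if Z.sign k then 1 else 0)) := by
  simp only [stack, Multiset.countP_add]
  refine ⟨fun i => ?_, fun j => ?_, fun k => ?_⟩
  · have e := countP_relabel (lowerLabel X Y Z) M.strands (.inl i) (.inl i)
      (by rintro (l | l) <;> simp [lowerLabel])
    have e' := countP_relabel_eq_zero (upperLabel X Y Z) N.strands (.inl i)
      (by rintro (l | l) <;> simp [upperLabel])
    rw [e.1, e.2, e'.1, e'.2, M.starts, M.ends]
    cases h : X.sign i <;> simp [isStart, h]
  · have e := countP_relabel (lowerLabel X Y Z) M.strands (.inr (.inl j)) (.inr j)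
      (by rintro (l | l) <;> simp [lowerLabel])
    have e' := countP_relabel (upperLabel X Y Z) N.strands (.inr (.inl j)) (.inl j)
      (by rintro (l | l) <;> simp [upperLabel])
    rw [e.1, e.2, e'.1, e'.2, M.starts, M.ends, N.starts, N.ends]
    cases h : Y.sign j <;> simp [isStart, h]
  · have e := countP_relabel_eq_zero (lowerLabel X Y Z) M.strands (.inr (.inr k))
      (by rintro (l | l) <;> simp [lowerLabel])
    have e' := countP_relabel (upperLabel X Y Z) N.strands (.inr (.inr k)) (.inr k)
      (by rintro (l | l) <;> simp [upperLabel])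
    rw [e.1, e.2, e'.1, e'.2, N.starts, N.ends]
    cases h : Z.sign k <;> simp [isStart, h]

theorem countP_glued (M : Cob S X Y) (N : Cob S Y Z) (b : Fin X.len ⊕ Fin Y.len ⊕ Fin Z.len)
    (hb : b ∉ middle X Y Z) :
    ((middle X Y Z).foldr glue (stack M N)).countP (fun p => p.src = some b) =
        (stack M N).countP (fun p => p.src = some b) ∧
      ((middle X Y Z).foldr glue (stack M N)).countP (fun p => p.tgt = some b) =
        (stack M N).countP (fun p => p.tgt = some b) := by
  have h := countP_foldr_glue (stack M N) (middle X Y Z) ?_ ?_ ?_ b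
  · rwa [if_neg hb, if_neg hb] at h
  · exact (List.nodup_finRange _).map fun i j h => by simpa using h
  · intro z hz
    obtain ⟨j, -, rfl⟩ := List.mem_map.1 hz
    exact ((countP_stack M N).2.1 j).1
  · intro z hz
    obtain ⟨j, -, rfl⟩ := List.mem_map.1 hz
    exact ((countP_stack M N).2.1 j).2

/-- Composition, in diagrammatic order: put `N` on top of `M` and glue along `Y`. -/
def comp (M : Cob S X Y) (N : Cob S Y Z) : Cob S X Z where
  strands := ((middle X Y Z).foldr glue (stack M N)).map (Strand.relabel (outerLabel X Y Z))
  starts := by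
    rintro (i | k)
    · rw [(countP_relabel (outerLabel X Y Z) _ (.inl i) (.inl i)
        (by rintro (l | l | l) <;> simp [outerLabel])).1, (countP_glued M N _ (by simp [middle])).1,
        ((countP_stack M N).1 i).1]
      rfl
    · rw [(countP_relabel (outerLabel X Y Z) _ (.inr k) (.inr (.inr k))
        (by rintro (l | l | l) <;> simp [outerLabel])).1, (countP_glued M N _ (by simp [middle])).1,
        ((countP_stack M N).2.2 k).1]
      cases h : Z.sign k <;> simp [isStart, h]
  ends := by
    rintro (i | k)
    · rw [(countP_relabel (outerLabel X Y Z) _ (.inl i) (.inl i)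
        (by rintro (l | l | l) <;> simp [outerLabel])).2, (countP_glued M N _ (by simp [middle])).2,
        ((countP_stack M N).1 i).2]
      rfl
    · rw [(countP_relabel (outerLabel X Y Z) _ (.inr k) (.inr (.inr k))
        (by rintro (l | l | l) <;> simp [outerLabel])).2, (countP_glued M N _ (by simp [middle])).2,
        ((countP_stack M N).2.2 k).2]
      cases h : Z.sign k <;> simp [isStart, h]

/-- Boundary points of the left factor of a tensor product. -/
def leftLabel (X Y X' Y' : SignSeq) : BdPt X Y → Option (BdPt (X.append X') (Y.append Y'))
  | .inl i => some (.inl (X.inLeft X' i))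
  | .inr j => some (.inr (Y.inLeft Y' j))

/-- Boundary points of the right factor of a tensor product. -/
def rightLabel (X Y X' Y' : SignSeq) : BdPt X' Y' → Option (BdPt (X.append X') (Y.append Y'))
  | .inl i => some (.inl (X.inRight X' i))
  | .inr j => some (.inr (Y.inRight Y' j))

/-- The disjoint union of two cobordisms, placed next to each other. -/
def beside (M : Cob S X Y) (N : Cob S X' Y') :
    Multiset (Strand S (BdPt (X.append X') (Y.append Y'))) :=
  M.strands.map (Strand.relabel (leftLabel X Y X' Y')) +
    N.strands.map (Strand.relabel (rightLabel X Y X' Y'))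

theorem countP_beside (M : Cob S X Y) (N : Cob S X' Y') (b : BdPt (X.append X') (Y.append Y')) :
    (beside M N).countP (fun p => p.src = some b) =
        (if isStart (X.append X') (Y.append Y') b then 1 else 0) ∧
      (beside M N).countP (fun p => p.tgt = some b) =
        (if isStart (X.append X') (Y.append Y') b then 0 else 1) := by
  rw [beside, Multiset.countP_add, Multiset.countP_add]
  obtain ⟨c, hc⟩ | ⟨c, hc⟩ : (∃ c, leftLabel X Y X' Y' c = some b) ∨
      ∃ c, rightLabel X Y X' Y' c = some b := by
    rcases b with i | i
    · obtain ⟨j, rfl⟩ | ⟨j, rfl⟩ := SignSeq.inLeft_or_inRight X X' i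
      · exact Or.inl ⟨.inl j, rfl⟩
      · exact Or.inr ⟨.inl j, rfl⟩
    · obtain ⟨j, rfl⟩ | ⟨j, rfl⟩ := SignSeq.inLeft_or_inRight Y Y' i
      · exact Or.inl ⟨.inr j, rfl⟩
      · exact Or.inr ⟨.inr j, rfl⟩
  · have e := countP_relabel (leftLabel X Y X' Y') M.strands b c (by
      intro l
      rw [← hc]
      rcases l with l | l <;> rcases c with c | c <;> simp [leftLabel])
    have e' := countP_relabel_eq_zero (rightLabel X Y X' Y') N.strands b (by
      intro l
      rw [← hc]
      rcases l with l | l <;> rcases c with c | c <;> simp [leftLabel, rightLabel])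
    have hs : isStart (X.append X') (Y.append Y') b = isStart X Y c := by
      rcases c with c | c <;> obtain rfl := Option.some.inj hc <;> simp [isStart]
    rw [e.1, e.2, e'.1, e'.2, hs, M.starts, M.ends]
    exact ⟨rfl, rfl⟩
  · have e := countP_relabel_eq_zero (leftLabel X Y X' Y') M.strands b (by
      intro l
      rw [← hc]
      rcases l with l | l <;> rcases c with c | c <;> simp [leftLabel, rightLabel])
    have e' := countP_relabel (rightLabel X Y X' Y') N.strands b c (by
      intro l
      rw [← hc]
      rcases l with l | l <;> rcases c with c | c <;> simp [rightLabel])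
    have hs : isStart (X.append X') (Y.append Y') b = isStart X' Y' c := by
      rcases c with c | c <;> obtain rfl := Option.some.inj hc <;> simp [isStart]
    rw [e.1, e.2, e'.1, e'.2, hs, N.starts, N.ends, zero_add, zero_add]
    exact ⟨rfl, rfl⟩

/-- The tensor product: put `N` to the right of `M`. -/
def tensor (M : Cob S X Y) (N : Cob S X' Y') : Cob S (X.append X') (Y.append Y') where
  strands := beside M N
  starts b := (countP_beside M N b).1
  ends b := (countP_beside M N b).2

theorem countP_univ_map {n : ℕ} {T : Type*} (f : Fin n → T) (P : T → Prop) [DecidablePred P]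
    (j : Fin n) (q : Bool) (h : ∀ i, P (f i) ↔ i = j ∧ q = true) :
    ((Finset.univ : Finset (Fin n)).val.map f).countP P = if q then 1 else 0 := by
  rw [Multiset.countP_map, ← Finset.filter_val, Finset.card_val,
    Finset.filter_congr (q := fun i => i = j ∧ q = true) fun i _ => h i]
  cases q <;> simp [Finset.filter_eq']

/-- The identity of `X`: a vertical interval at each point, oriented upwards at `+` and downwards
at `-`. -/
def id (S : Type*) (X : SignSeq) : Cob S X X where
  strands := (Finset.univ : Finset (Fin X.len)).val.map fun i =>
    .arc (some (if X.sign i then .inl i else .inr i)) (some (if X.sign i then .inr i else .inl i)) 1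
  starts := by
    rintro (j | j)
    · refine countP_univ_map _ _ j _ fun i => ?_
      by_cases hi : X.sign i = true <;> simp [Strand.src, isStart, hi] <;> rintro rfl <;> simp_all
    · refine countP_univ_map _ _ j _ fun i => ?_
      by_cases hi : X.sign i = true <;> simp [Strand.src, isStart, hi] <;> rintro rfl <;> simp_all
  ends := by
    rintro (j | j)
    · refine (countP_univ_map _ _ j (!isStart X X (.inl j)) fun i => ?_).trans ?_
      · by_cases hi : X.sign i = true <;> simp [Strand.tgt, isStart, hi] <;> rintro rfl <;>
          simp_all
      · cases isStart X X (.inl j) <;> rfl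
    · refine (countP_univ_map _ _ j (!isStart X X (.inr j)) fun i => ?_).trans ?_
      · by_cases hi : X.sign i = true <;> simp [Strand.tgt, isStart, hi] <;> rintro rfl <;>
          simp_all
      · cases isStart X X (.inr j) <;> rfl

/-- The empty cobordism, the identity of the empty sequence. -/
def nil (S : Type*) : Cob S SignSeq.empty SignSeq.empty where
  strands := 0
  starts := by rintro (i | i) <;> exact i.elim0
  ends := by rintro (i | i) <;> exact i.elim0

/-- A floating interval with the word `w`. -/
def floatingInterval (w : FreeMonoid S) : Cob S SignSeq.empty SignSeq.empty where
  strands := {.arc none none w}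
  starts := by rintro (i | i) <;> exact i.elim0
  ends := by rintro (i | i) <;> exact i.elim0

/-- A floating circle with the word `w`. -/
def floatingCircle (w : FreeMonoid S) : Cob S SignSeq.empty SignSeq.empty where
  strands := {.circle (w.toList : Cycle S)}
  starts := by rintro (i | i) <;> exact i.elim0
  ends := by rintro (i | i) <;> exact i.elim0

/-- The upward interval from `(+)` to `(+)` with the word `w`. -/
def through (w : FreeMonoid S) : Cob S (SignSeq.one true) (SignSeq.one true) where
  strands := {.arc (some (.inl (0 : Fin 1))) (some (.inr (0 : Fin 1))) w}
  starts := by rintro (i | i) <;> fin_cases i <;> rfl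
  ends := by rintro (i | i) <;> fin_cases i <;> rfl

/-- The interval with the word `w` from a floating endpoint to the top point `(+)`. -/
def fromFloating (w : FreeMonoid S) : Cob S SignSeq.empty (SignSeq.one true) where
  strands := {.arc none (some (.inr (0 : Fin 1))) w}
  starts := by rintro (i | i); exacts [i.elim0, by fin_cases i; rfl]
  ends := by rintro (i | i); exacts [i.elim0, by fin_cases i; rfl]

/-- The interval with the word `w` from the top point `(-)` to a floating endpoint. -/
def toFloating (w : FreeMonoid S) : Cob S SignSeq.empty (SignSeq.one false) where
  strands := {.arc (some (.inr (0 : Fin 1))) none w}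
  starts := by rintro (i | i); exacts [i.elim0, by fin_cases i; rfl]
  ends := by rintro (i | i); exacts [i.elim0, by fin_cases i; rfl]

end Cob

/-! ### The linearization and the skein category -/

section Skein

variable (K : Type*) [Field K] {S : Type*}

/-- Morphisms of the linearized category: finite linear combinations of cobordisms. -/
abbrev LinCob (S : Type*) (X Y : SignSeq) := Cob S X Y →₀ K

variable {K}

/-- Write a noncommutative polynomial instead of a word on a cobordism `F`, by linearity. -/
noncomputable def placePoly {X Y : SignSeq} (F : FreeMonoid S → Cob S X Y) :
    NCPoly K S →ₗ[K] LinCob K S X Y :=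
  (Finsupp.lmapDomain K K F).comp (MonoidAlgebra.coeffLinearEquiv K).toLinearMap

/-- The linear combinations of cobordisms that vanish in the skein category of the pair `(a, c)`:
the smallest family of subspaces of the morphism spaces of the linearized category that is closed
under composition and tensor products with arbitrary cobordisms on either side and contains the
following. A floating interval with word `w` is `a w`, a floating circle with word `w` is `c w`;
an element of the syntactic ideal of the pair is zero on the interval from `(+)` to `(+)`; an
element of the left syntactic ideal of `a` is zero on an interval oriented away from its floating
endpoint, and an element of the right syntactic ideal of `a` is zero on an interval oriented
towards its floating endpoint. -/
inductive IsSkeinZero (a c : FreeMonoid S → K) : {X Y : SignSeq} → LinCob K S X Y → Prop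
  | floatingInterval (w : FreeMonoid S) : IsSkeinZero a c
      (Finsupp.single (Cob.floatingInterval w) 1 - a w • Finsupp.single (Cob.nil S) 1)
  | floatingCircle (w : FreeMonoid S) : IsSkeinZero a c
      (Finsupp.single (Cob.floatingCircle w) 1 - c w • Finsupp.single (Cob.nil S) 1)
  | through (u : NCPoly K S) (hu : u ∈ pairSyntactic a c) :
      IsSkeinZero a c (placePoly Cob.through u)
  | fromFloating (u : NCPoly K S) (hu : u ∈ leftSyntactic a) :
      IsSkeinZero a c (placePoly Cob.fromFloating u)
  | toFloating (u : NCPoly K S) (hu : u ∈ rightSyntactic a) :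
      IsSkeinZero a c (placePoly Cob.toFloating u)
  | zero {X Y : SignSeq} : IsSkeinZero a c (0 : LinCob K S X Y)
  | add {X Y : SignSeq} (x y : LinCob K S X Y) (hx : IsSkeinZero a c x)
      (hy : IsSkeinZero a c y) : IsSkeinZero a c (x + y)
  | smul {X Y : SignSeq} (r : K) (x : LinCob K S X Y) (hx : IsSkeinZero a c x) :
      IsSkeinZero a c (r • x)
  | comp_below {X Y Z : SignSeq} (M : Cob S X Y) (x : LinCob K S Y Z) (hx : IsSkeinZero a c x) :
      IsSkeinZero a c (Finsupp.lmapDomain K K (fun N => M.comp N) x)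
  | comp_above {X Y Z : SignSeq} (x : LinCob K S X Y) (N : Cob S Y Z) (hx : IsSkeinZero a c x) :
      IsSkeinZero a c (Finsupp.lmapDomain K K (fun M => M.comp N) x)
  | tensor_left {X Y X' Y' : SignSeq} (M : Cob S X Y) (x : LinCob K S X' Y')
      (hx : IsSkeinZero a c x) : IsSkeinZero a c (Finsupp.lmapDomain K K (fun N => M.tensor N) x)
  | tensor_right {X Y X' Y' : SignSeq} (x : LinCob K S X Y) (N : Cob S X' Y')
      (hx : IsSkeinZero a c x) : IsSkeinZero a c (Finsupp.lmapDomain K K (fun M => M.tensor N) x)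

/-- The subspace of linear combinations of cobordisms that vanish in the skein category. -/
def skeinIdeal (a c : FreeMonoid S → K) (X Y : SignSeq) : Submodule K (LinCob K S X Y) where
  carrier := {x | IsSkeinZero a c x}
  zero_mem' := .zero
  add_mem' hx hy := .add _ _ hx hy
  smul_mem' r x hx := .smul r x hx

/-- The hom space from `X` to `Y` in the skein category of the pair `(a, c)`. -/
abbrev SkeinHom (a c : FreeMonoid S → K) (X Y : SignSeq) := LinCob K S X Y ⧸ skeinIdeal a c X Y

end Skein

/-! ### The basis -/

/-- A viewable cobordism without dots: a finite set of oriented intervals, each with at least one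
endpoint on the boundary and given by its starting point and its end point (`none` if floating),
such that each boundary point is the endpoint of exactly one of them, with the right
orientation. -/
@[ext] structure ViewableCob (X Y : SignSeq) where
  arcs : Finset (Option (BdPt X Y) × Option (BdPt X Y))
  viewable : (none, none) ∉ arcs
  starts : ∀ b, (arcs.filter (fun p => p.1 = some b)).card = if isStart X Y b then 1 else 0
  ends : ∀ b, (arcs.filter (fun p => p.2 = some b)).card = if isStart X Y b then 0 else 1

namespace ViewableCob

variable {K : Type*} [Field K] {S : Type*} {X Y : SignSeq}

/-- The cobordism with the words `w` written on the components of `x`. -/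
def decorate (x : ViewableCob X Y) (w : x.arcs → FreeMonoid S) : Cob S X Y where
  strands := (Finset.univ : Finset x.arcs).val.map fun p => .arc p.1.1 p.1.2 (w p)
  starts b := by
    rw [← x.starts b, Multiset.countP_map, ← Finset.filter_val, Finset.card_val]
    refine Finset.card_bij (fun p _ => p.1) ?_ ?_ ?_
    · rintro ⟨p, hp⟩ h
      exact Finset.mem_filter.2 ⟨hp, (Finset.mem_filter.1 h).2⟩
    · rintro p - q - h
      exact Subtype.ext h
    · intro p hp
      obtain ⟨hp, h⟩ := Finset.mem_filter.1 hp
      exact ⟨⟨p, hp⟩, Finset.mem_filter.2 ⟨Finset.mem_univ _, h⟩, rfl⟩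
  ends b := by
    rw [← x.ends b, Multiset.countP_map, ← Finset.filter_val, Finset.card_val]
    refine Finset.card_bij (fun p _ => p.1) ?_ ?_ ?_
    · rintro ⟨p, hp⟩ h
      exact Finset.mem_filter.2 ⟨hp, (Finset.mem_filter.1 h).2⟩
    · rintro p - q - h
      exact Subtype.ext h
    · intro p hp
      obtain ⟨hp, h⟩ := Finset.mem_filter.1 hp
      exact ⟨⟨p, hp⟩, Finset.mem_filter.2 ⟨Finset.mem_univ _, h⟩, rfl⟩

/-- The linear combination of cobordisms obtained by writing the polynomials `d` on the components
of `x`, expanded multilinearly. -/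
noncomputable def decoratePoly (x : ViewableCob X Y) (d : x.arcs → NCPoly K S) :
    LinCob K S X Y :=
  ∑ w ∈ Fintype.piFinset (fun p => (d p).coeff.support),
    Finsupp.single (x.decorate w) (∏ p, (d p).coeff (w p))

end ViewableCob

section Basis

variable {K : Type*} [Field K] {S : Type*}

/-- The polynomials allowed on a component: `B` if both endpoints are boundary points, `Bl` if the
component is oriented away from its floating endpoint, `Br` if it is oriented towards it. -/
def allowed {L : Type*} (B Bl Br : Set (NCPoly K S)) : Option L × Option L → Set (NCPoly K S)
  | (some _, some _) => B
  | (none, some _) => Bl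
  | (some _, none) => Br
  | (none, none) => ∅

/-- Viewable cobordisms from `X` to `Y` whose components carry allowed polynomials. -/
def BasicCob (B Bl Br : Set (NCPoly K S)) (X Y : SignSeq) :=
  Σ x : ViewableCob X Y, ∀ p : x.arcs, allowed B Bl Br p.1

/-- The morphism of the skein category given by a viewable cobordism with polynomials on its
components. -/
noncomputable def BasicCob.toSkeinHom (a c : FreeMonoid S → K) {B Bl Br : Set (NCPoly K S)}
    {X Y : SignSeq} (x : BasicCob B Bl Br X Y) : SkeinHom a c X Y :=
  (skeinIdeal a c X Y).mkQ (x.1.decoratePoly fun p => (x.2 p : NCPoly K S))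

end Basis

/-! ### The ideal attached to each type of interval. -/

section Ideals

variable {K S : Type*} [Field K]

/-! A pair of endpoints, each a boundary point or floating, determines a subspace `arcIdeal` of
polynomials: the two-sided, left or right syntactic ideal, or the kernel of `seriesEval a` when both
ends float. These subspaces are compatible with gluing: joining at a non-floating end multiplies the
polynomial on the side where the ideal is stable, and an end that becomes floating only enlarges the
ideal. Closing up an interval with two non-floating ends gives a circle on which `c` vanishes.

Therefore the skein ideal of a hom space is contained in the span of "local relations", which alter
a single component of an arbitrary cobordism (`IsSkeinZero.mem_span`). Linear independence follows
by evaluation. Each component gets a value in a commutative algebra `R`, and a cobordism gets the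
product. If the value of an interval is linear in its polynomial and kills `arcIdeal`, and if
floating components get their values under `a` and `c`, then all local relations go to zero.
Symmetry of `c` makes the value of a circle well defined. For `R` take a polynomial ring with one
variable for each pair of endpoints together with each polynomial; sending each allowed polynomial
to its own variable maps the basic cobordisms to distinct monomials
(`linearIndependent_toSkeinHom`).

Spanning needs the converse: the defining relations imply the relations on one component of any
cobordism. The component is cut open, so that the cobordism becomes a fixed one with a small
generating piece plugged in from below (`Cob.plug`, `isSkeinZero_insert`, `isSkeinZero_remove`).
Then floating components turn into scalars. What remains is viewable and multilinear in its
polynomials, each of which is a combination of basis representatives and an element of `arcIdeal`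
(`span_toSkeinHom`).

Finiteness comes from recognizability: the kernel of a matrix representation has finite codimension
and lies in the two-sided syntactic ideal. -/

theorem seriesEval_single (a : FreeMonoid S → K) (w : FreeMonoid S) :
    seriesEval a (MonoidAlgebra.single w 1) = a w := by
  simp [seriesEval]

theorem mem_leftSyntactic {a : FreeMonoid S → K} {x : NCPoly K S} :
    x ∈ leftSyntactic a ↔ ∀ y, seriesEval a (y * x) = 0 := by
  simp [leftSyntactic]

theorem mem_rightSyntactic {a : FreeMonoid S → K} {x : NCPoly K S} :
    x ∈ rightSyntactic a ↔ ∀ y, seriesEval a (x * y) = 0 := by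
  simp [rightSyntactic]

theorem mem_twoSidedSyntactic {a : FreeMonoid S → K} {x : NCPoly K S} :
    x ∈ twoSidedSyntactic a ↔ ∀ y z, seriesEval a (y * x * z) = 0 := by
  simp [twoSidedSyntactic]

theorem mem_pairSyntactic {a c : FreeMonoid S → K} {x : NCPoly K S} :
    x ∈ pairSyntactic a c ↔
      (∀ y z, seriesEval a (y * x * z) = 0) ∧ ∀ y z, seriesEval c (y * x * z) = 0 := by
  simp [pairSyntactic, mem_twoSidedSyntactic]

/-- The polynomials that evaluate to zero on an interval with the given endpoints. -/
noncomputable def arcIdeal {L : Type*} (a c : FreeMonoid S → K) :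
    Option L → Option L → Submodule K (NCPoly K S)
  | some _, some _ => pairSyntactic a c
  | none, some _ => leftSyntactic a
  | some _, none => rightSyntactic a
  | none, none => LinearMap.ker (seriesEval a)

/-- An endpoint that becomes floating removes a factor `y` or `z` from the vanishing condition.
Setting that factor to `1` shows that the ideal can only grow. -/
theorem arcIdeal_bind_le {L L' : Type*} (a c : FreeMonoid S → K) (f g : L → Option L')
    (s t : Option L) : arcIdeal a c s t ≤ arcIdeal a c (s.bind f) (t.bind g) := by
  have h1 : pairSyntactic a c ≤ leftSyntactic a := fun x hx =>
    mem_leftSyntactic.2 fun y => by simpa using (mem_pairSyntactic.1 hx).1 y 1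
  have h2 : pairSyntactic a c ≤ rightSyntactic a := fun x hx =>
    mem_rightSyntactic.2 fun y => by simpa using (mem_pairSyntactic.1 hx).1 1 y
  have h3 : leftSyntactic a ≤ LinearMap.ker (seriesEval a) := fun x hx => by
    simpa using mem_leftSyntactic.1 hx 1
  have h4 : rightSyntactic a ≤ LinearMap.ker (seriesEval a) := fun x hx => by
    simpa using mem_rightSyntactic.1 hx 1
  rcases s with _ | s <;> rcases t with _ | t
  · exact le_rfl
  · rcases h : g t with _ | t' <;> simp only [Option.bind, h, arcIdeal, le_refl, h3]
  · rcases h : f s with _ | s' <;> simp only [Option.bind, h, arcIdeal, le_refl, h4]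
  · rcases h : f s with _ | s' <;> rcases h' : g t with _ | t' <;>
      simp only [Option.bind, h, h', arcIdeal, le_refl, h1, h2, h1.trans h3]

theorem arcIdeal_le_of_src {L : Type*} (a c : FreeMonoid S → K) (z : L) (s t : Option L) :
    arcIdeal a c (some z) t ≤ arcIdeal a c s t := by
  simpa using arcIdeal_bind_le a c (fun _ => s) some (some z) t

theorem arcIdeal_le_of_tgt {L : Type*} (a c : FreeMonoid S → K) (z : L) (s t : Option L) :
    arcIdeal a c s (some z) ≤ arcIdeal a c s t := by
  simpa using arcIdeal_bind_le a c some (fun _ => t) s (some z)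

/-- Words are read from right to left, so whatever is joined to the start of an interval multiplies
on the right. The condition for a non-floating start already quantifies over a right factor, which
absorbs `y`. -/
theorem mul_mem_arcIdeal_of_src {L : Type*} {a c : FreeMonoid S → K} {z : L} {t : Option L}
    {x : NCPoly K S} (hx : x ∈ arcIdeal a c (some z) t) (y : NCPoly K S) :
    x * y ∈ arcIdeal a c (some z) t := by
  rcases t with _ | t
  · exact mem_rightSyntactic.2 fun v => by rw [mul_assoc]; exact mem_rightSyntactic.1 hx _
  · refine mem_pairSyntactic.2 ⟨fun v w => ?_, fun v w => ?_⟩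
    · simpa [mul_assoc] using (mem_pairSyntactic.1 hx).1 v (y * w)
    · simpa [mul_assoc] using (mem_pairSyntactic.1 hx).2 v (y * w)

theorem mul_mem_arcIdeal_of_tgt {L : Type*} {a c : FreeMonoid S → K} {z : L} {s : Option L}
    {x : NCPoly K S} (hx : x ∈ arcIdeal a c s (some z)) (y : NCPoly K S) :
    y * x ∈ arcIdeal a c s (some z) := by
  rcases s with _ | s
  · exact mem_leftSyntactic.2 fun v => by rw [← mul_assoc]; exact mem_leftSyntactic.1 hx _
  · refine mem_pairSyntactic.2 ⟨fun v w => ?_, fun v w => ?_⟩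
    · simpa [mul_assoc] using (mem_pairSyntactic.1 hx).1 (v * y) w
    · simpa [mul_assoc] using (mem_pairSyntactic.1 hx).2 (v * y) w

end Ideals

/-! ### Finite codimension of the ideals, and representatives of bases of quotients. -/

section Finiteness

variable {K S : Type*} [Field K]

/-- The kernel of a matrix representation that recognizes `a` lies in the two-sided syntactic
ideal. -/
theorem IsRecognizable.exists_ker_le {a : FreeMonoid S → K} (ha : IsRecognizable a) :
    ∃ (n : ℕ) (ψ : NCPoly K S →ₐ[K] Matrix (Fin n) (Fin n) K),
      LinearMap.ker ψ.toLinearMap ≤ twoSidedSyntactic a := by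
  obtain ⟨n, ψ, μ, ξ, h⟩ := ha
  refine ⟨n, ψ, fun x hx => mem_twoSidedSyntactic.2 fun y z => ?_⟩
  -- The formula for `a` on words extends linearly to all polynomials. Since `ψ` is multiplicative,
  -- `ψ x = 0` then makes every `y * x * z` evaluate to zero.
  let φ : NCPoly K S →ₗ[K] K :=
    { toFun := fun u => μ ⬝ᵥ (ψ u).mulVec ξ
      map_add' := fun u v => by simp [Matrix.add_mulVec]
      map_smul' := fun r u => by simp [Matrix.smul_mulVec] }
  have e : seriesEval a = φ := by
    refine MonoidAlgebra.lhom_ext' fun w => LinearMap.ext_ring ?_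
    simpa [φ] using (seriesEval_single a w).trans (h w)
  have hx' : ψ x = 0 := hx
  simp [e, φ, hx']

theorem finiteDimensional_quotient_pairSyntactic {a c : FreeMonoid S → K}
    (ha : IsRecognizable a) (hc : IsRecognizable c) :
    FiniteDimensional K (NCPoly K S ⧸ pairSyntactic a c) := by
  obtain ⟨n, ψ, hψ⟩ := ha.exists_ker_le
  obtain ⟨m, φ, hφ⟩ := hc.exists_ker_le
  let f := ψ.toLinearMap.prod φ.toLinearMap
  have hf : LinearMap.ker f ≤ pairSyntactic a c := by
    rw [LinearMap.ker_prod]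
    exact inf_le_inf hψ hφ
  have : FiniteDimensional K (NCPoly K S ⧸ LinearMap.ker f) :=
    Module.Finite.equiv f.quotKerEquivRange.symm
  exact Module.Finite.of_surjective (Submodule.factor hf) (Submodule.factor_surjective hf)

theorem finiteDimensional_quotient_arcIdeal {L : Type*} {a c : FreeMonoid S → K}
    (ha : IsRecognizable a) (hc : IsRecognizable c) (s t : Option L) :
    FiniteDimensional K (NCPoly K S ⧸ arcIdeal a c s t) := by
  have : FiniteDimensional K (NCPoly K S ⧸ arcIdeal a c (some ()) (some ())) :=
    finiteDimensional_quotient_pairSyntactic ha hc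
  -- The ideal for two boundary endpoints is the smallest of the four, so its finite codimension
  -- implies that of the others.
  have h := arcIdeal_bind_le a c (fun _ : Unit => s) (fun _ => t) (some ()) (some ())
  exact Module.Finite.of_surjective (Submodule.factor h) (Submodule.factor_surjective h)

variable {V : Type*} [AddCommGroup V] [Module K V] {I : Submodule K V} {B : Set V}

theorem DescendsToBasis.finite (h : DescendsToBasis I B) [FiniteDimensional K (V ⧸ I)] :
    Finite B := h.1.finite

/-- A function on a set of representatives of a basis of `V ⧸ I` extends to a linear map that
vanishes on `I`. -/
theorem DescendsToBasis.exists_linearMap (h : DescendsToBasis I B) {M : Type*} [AddCommGroup M]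
    [Module K M] (f : V → M) : ∃ θ : V →ₗ[K] M, (∀ x ∈ I, θ x = 0) ∧ ∀ b ∈ B, θ b = f b := by
  have hs : ⊤ ≤ Submodule.span K (Set.range fun b : B => I.mkQ b) := by
    rw [← h.2, Set.image_eq_range]
  let β := Module.Basis.mk h.1 hs
  refine ⟨(β.constr K fun b => f b).comp I.mkQ, fun x hx => ?_, fun b hb => ?_⟩
  · rw [LinearMap.comp_apply, (Submodule.Quotient.mk_eq_zero I).2 hx |> (id : _ → I.mkQ x = 0),
      map_zero]
  · have e : I.mkQ b = β ⟨b, hb⟩ := by rw [Module.Basis.mk_apply]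
    rw [LinearMap.comp_apply, e, Module.Basis.constr_basis]

/-- This lets multilinear arguments treat each polynomial as either a basis representative or an
element of the ideal. -/
theorem DescendsToBasis.span_union (h : DescendsToBasis I B) :
    Submodule.span K (B ∪ (I : Set V)) = ⊤ := by
  refine eq_top_iff.2 fun x _ => ?_
  rw [Submodule.span_union, Submodule.span_eq, ← I.ker_mkQ]
  have hx : I.mkQ x ∈ (Submodule.span K B).map I.mkQ := by
    rw [Submodule.map_span, h.2]; trivial
  obtain ⟨y, hy, e⟩ := hx
  rw [← sub_add_cancel x y, add_comm]
  refine Submodule.add_mem_sup hy ?_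
  rw [LinearMap.mem_ker, map_sub, e, sub_self]

theorem allowed_descendsToBasis {L : Type*} {a c : FreeMonoid S → K} {B Bl Br : Set (NCPoly K S)}
    (hB : DescendsToBasis (pairSyntactic a c) B) (hBl : DescendsToBasis (leftSyntactic a) Bl)
    (hBr : DescendsToBasis (rightSyntactic a) Br) (p : Option L × Option L)
    (hp : p ≠ (none, none)) :
    DescendsToBasis (arcIdeal a c p.1 p.2) (allowed B Bl Br p) := by
  obtain ⟨_ | s, _ | t⟩ := p
  exacts [absurd rfl hp, hBl, hBr, hB]

end Finiteness

/-! ### Components that avoid the glued points. -/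

section Glue

variable {S L L' : Type*}

theorem glue_cons_of_ne [DecidableEq L] (z : L) (p : Strand S L) (R : Multiset (Strand S L))
    (h1 : p.src ≠ some z) (h2 : p.tgt ≠ some z) : glue z (p ::ₘ R) = p ::ₘ glue z R := by
  simp [glue, h1, h2]

theorem foldr_glue_cons_of_ne [DecidableEq L] (l : List L) (p : Strand S L)
    (R : Multiset (Strand S L)) (h1 : ∀ z ∈ l, p.src ≠ some z) (h2 : ∀ z ∈ l, p.tgt ≠ some z) :
    l.foldr glue (p ::ₘ R) = p ::ₘ l.foldr glue R := by
  induction l with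
  | nil => rfl
  | cons z l ih =>
    rw [List.foldr_cons, List.foldr_cons, ih (fun y hy => h1 y (List.mem_cons_of_mem _ hy))
      (fun y hy => h2 y (List.mem_cons_of_mem _ hy)),
      glue_cons_of_ne z p _ (h1 z List.mem_cons_self) (h2 z List.mem_cons_self)]

theorem foldr_glue_add_of_ne [DecidableEq L] (l : List L) (P R : Multiset (Strand S L))
    (h : ∀ p ∈ P, ∀ z ∈ l, p.src ≠ some z ∧ p.tgt ≠ some z) :
    l.foldr glue (P + R) = P + l.foldr glue R := by
  induction P using Multiset.induction_on with
  | empty => simp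
  | cons p P ih =>
    rw [Multiset.cons_add, foldr_glue_cons_of_ne l p _
      (fun z hz => (h p (Multiset.mem_cons_self p P) z hz).1)
      (fun z hz => (h p (Multiset.mem_cons_self p P) z hz).2),
      ih (fun q hq => h q (Multiset.mem_cons_of_mem hq)), Multiset.cons_add]

@[simp] theorem Strand.src_arc (s t : Option L) (w : FreeMonoid S) :
    (Strand.arc s t w).src = s := rfl

@[simp] theorem Strand.tgt_arc (s t : Option L) (w : FreeMonoid S) :
    (Strand.arc s t w).tgt = t := rfl

end Glue

/-! ### Ideal elements on one component, under relabelling and gluing. -/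

section Families

variable {K S : Type*} [Field K] {L L' : Type*}

/-- A component into which a word is inserted, such that inserting the polynomial `u` gives an
element of the respective ideal. -/
def IsNullComponent (a c : FreeMonoid S → K) (u : NCPoly K S) (P : FreeMonoid S → Strand S L) :
    Prop :=
  (∃ s t v v', (∀ w, P w = .arc s t (v * w * v')) ∧
    MonoidAlgebra.single v 1 * u * MonoidAlgebra.single v' 1 ∈ arcIdeal a c s t) ∨
  (∃ v v', (∀ w, P w = .circle ((v * w * v').toList : Cycle S)) ∧
    seriesEval c (MonoidAlgebra.single v 1 * u * MonoidAlgebra.single v' 1) = 0)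

/-- A collection of components, into one of which a word is inserted, such that inserting the
polynomial `u` gives an element of the respective ideal. -/
def IsNullFamily (a c : FreeMonoid S → K) (u : NCPoly K S)
    (D : FreeMonoid S → Multiset (Strand S L)) : Prop :=
  ∃ P R, IsNullComponent a c u P ∧ ∀ w, D w = P w ::ₘ R

variable {a c : FreeMonoid S → K} {u : NCPoly K S} {D : FreeMonoid S → Multiset (Strand S L)}

theorem IsNullFamily.add (h : IsNullFamily a c u D) (R : Multiset (Strand S L)) :
    IsNullFamily a c u (fun w => D w + R) := by
  obtain ⟨P, R', hP, hD⟩ := h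
  exact ⟨P, R' + R, hP, fun w => (congrArg (· + R) (hD w)).trans (Multiset.cons_add _ _ _)⟩

theorem IsNullFamily.relabel (h : IsNullFamily a c u D) (f : L → Option L') :
    IsNullFamily a c u (fun w => (D w).map (Strand.relabel f)) := by
  obtain ⟨P, R, hP, hD⟩ := h
  refine ⟨fun w => (P w).relabel f, R.map (Strand.relabel f), ?_, fun w =>
    (congrArg (Multiset.map (Strand.relabel f)) (hD w)).trans (Multiset.map_cons _ _ _)⟩
  obtain ⟨s, t, v, v', hP, hu⟩ | ⟨v, v', hP, hu⟩ := hP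
  · exact Or.inl ⟨s.bind f, t.bind f, v, v', fun w => congrArg (Strand.relabel f) (hP w),
      arcIdeal_bind_le a c f f s t hu⟩
  · exact Or.inr ⟨v, v', fun w => congrArg (Strand.relabel f) (hP w), hu⟩

/-- The component with the inserted word can meet the glued point at its start, at its end, at both
or at neither. Everything joined to it carries a fixed word, which is absorbed into `v` or `v'`. -/
theorem IsNullFamily.glue [DecidableEq L] (h : IsNullFamily a c u D) (z : L)
    (h1 : ∀ w, (D w).countP (fun p => p.src = some z) = 1)
    (h2 : ∀ w, (D w).countP (fun p => p.tgt = some z) = 1) :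
    IsNullFamily a c u (fun w => glue z (D w)) := by
  obtain ⟨P, R, hP, hD⟩ := h
  obtain rfl : D = fun w => P w ::ₘ R := funext hD
  obtain ⟨s, t, v, v', hP, hu⟩ | ⟨v, v', hP, hu⟩ := hP
  · obtain rfl : P = fun w => .arc s t (v * w * v') := funext hP
    have k1 := h1 1
    have k2 := h2 1
    rw [countP_src_cons, Strand.src_arc] at k1
    rw [countP_tgt_cons, Strand.tgt_arc] at k2
    by_cases hs : s = some z <;> by_cases ht : t = some z
    -- The component closes to a circle. Here the ideal is `pairSyntactic`, whose second condition
    -- with outer factors `1` is the vanishing under `c`.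
    · subst hs ht
      rw [if_pos rfl] at k1 k2
      have k1' := Multiset.countP_eq_zero.1 (Nat.succ_injective k1)
      have k2' := Multiset.countP_eq_zero.1 (Nat.succ_injective k2)
      refine ⟨fun w => .circle ((v * w * v').toList : Cycle S), R, Or.inr ⟨v, v', fun w => rfl, ?_⟩,
        fun w => glue_eq_close z R (fun p hp => ⟨k1' p hp, k2' p hp⟩) _ rfl rfl⟩
      simpa using (mem_pairSyntactic.1 hu).2 1 1
    -- The start is glued to the end of some `p`: the word of `p` multiplies on the right, and the
    -- start of `p` becomes the new start, possibly floating.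
    · subst hs
      rw [if_pos rfl] at k1
      rw [if_neg ht] at k2
      have k1' := Multiset.countP_eq_zero.1 (Nat.succ_injective k1)
      obtain ⟨p, hp, hpz⟩ := Multiset.countP_pos.1 (k2.symm ▸ one_pos)
      obtain ⟨R, rfl⟩ := Multiset.exists_cons_of_mem hp
      rw [add_zero, countP_tgt_cons, if_pos hpz] at k2
      have k2' := Multiset.countP_eq_zero.1 (Nat.succ_injective k2)
      refine ⟨fun w => p.join (.arc (some z) t (v * w * v')), R,
        Or.inl ⟨p.src, t, v, v' * p.word, fun w => ?_, ?_⟩, fun w => ?_⟩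
      · simp only [Strand.join, Strand.word, Strand.tgt, mul_assoc]
      · have := arcIdeal_le_of_src a c z p.src t
          (mul_mem_arcIdeal_of_src hu (MonoidAlgebra.single p.word 1))
        simpa [mul_assoc, MonoidAlgebra.single_mul_single] using this
      · refine (congrArg (_root_.glue z) (Multiset.cons_swap _ _ _)).trans ?_
        exact glue_eq_join z R
          (fun q hq => ⟨k1' q (Multiset.mem_cons_of_mem hq), k2' q hq⟩) p _
          (k1' p (Multiset.mem_cons_self p R)) hpz rfl ht
    -- The mirror image: the word of `p` multiplies on the left, and the end of `p` becomes the new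
    -- end.
    · subst ht
      rw [if_pos rfl] at k2
      rw [if_neg hs] at k1
      have k2' := Multiset.countP_eq_zero.1 (Nat.succ_injective k2)
      obtain ⟨p, hp, hpz⟩ := Multiset.countP_pos.1 (k1.symm ▸ one_pos)
      obtain ⟨R, rfl⟩ := Multiset.exists_cons_of_mem hp
      rw [add_zero, countP_src_cons, if_pos hpz] at k1
      have k1' := Multiset.countP_eq_zero.1 (Nat.succ_injective k1)
      refine ⟨fun w => Strand.join (.arc s (some z) (v * w * v')) p, R,
        Or.inl ⟨s, p.tgt, p.word * v, v', fun w => ?_, ?_⟩, fun w => ?_⟩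
      · simp only [Strand.join, Strand.word, Strand.src, mul_assoc]
      · have := arcIdeal_le_of_tgt a c z s p.tgt
          (mul_mem_arcIdeal_of_tgt hu (MonoidAlgebra.single p.word 1))
        simpa [← mul_assoc, MonoidAlgebra.single_mul_single] using this
      · exact glue_eq_join z R
          (fun q hq => ⟨k1' q hq, k2' q (Multiset.mem_cons_of_mem hq)⟩) _ p
          hs rfl hpz (k2' p (Multiset.mem_cons_self p R))
    · exact ⟨_, _root_.glue z R, Or.inl ⟨s, t, v, v', fun w => rfl, hu⟩,
        fun w => glue_cons_of_ne z _ R hs ht⟩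
  · refine ⟨P, _root_.glue z R, Or.inr ⟨v, v', hP, hu⟩, fun w => glue_cons_of_ne z _ R ?_ ?_⟩ <;>
      simp [hP, Strand.src, Strand.tgt]

theorem IsNullFamily.foldr_glue [DecidableEq L] (h : IsNullFamily a c u D) (l : List L)
    (hl : l.Nodup) (h1 : ∀ w, ∀ z ∈ l, (D w).countP (fun p => p.src = some z) = 1)
    (h2 : ∀ w, ∀ z ∈ l, (D w).countP (fun p => p.tgt = some z) = 1) :
    IsNullFamily a c u (fun w => l.foldr _root_.glue (D w)) := by
  induction l with
  | nil => exact h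
  | cons z l ih =>
    rw [List.nodup_cons] at hl
    have k1 : ∀ w, ∀ y ∈ l, (D w).countP (fun p => p.src = some y) = 1 :=
      fun w y hy => h1 w y (List.mem_cons_of_mem _ hy)
    have k2 : ∀ w, ∀ y ∈ l, (D w).countP (fun p => p.tgt = some y) = 1 :=
      fun w y hy => h2 w y (List.mem_cons_of_mem _ hy)
    refine (ih hl.2 k1 k2).glue z (fun w => ?_) fun w => ?_
    · rw [(countP_foldr_glue (D w) l hl.2 (k1 w) (k2 w) z).1, if_neg hl.1,
        h1 w z List.mem_cons_self]
    · rw [(countP_foldr_glue (D w) l hl.2 (k1 w) (k2 w) z).2, if_neg hl.1,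
        h2 w z List.mem_cons_self]

end Families

/-! ### Skein relations are combinations of relations on a single component. -/

section Relations

variable {K S : Type*} [Field K] {X Y Z X' Y' : SignSeq}

/-- The skein relations, applied to one component of an arbitrary cobordism. -/
inductive IsLocalRelation (a c : FreeMonoid S → K) : LinCob K S X Y → Prop
  | interval (N N' : Cob S X Y) (w : FreeMonoid S)
      (h : N.strands = .arc none none w ::ₘ N'.strands) :
      IsLocalRelation a c (Finsupp.single N 1 - a w • Finsupp.single N' 1)
  | circle (N N' : Cob S X Y) (w : FreeMonoid S)
      (h : N.strands = .circle (w.toList : Cycle S) ::ₘ N'.strands) :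
      IsLocalRelation a c (Finsupp.single N 1 - c w • Finsupp.single N' 1)
  | family (N : FreeMonoid S → Cob S X Y) (u : NCPoly K S)
      (h : IsNullFamily a c u fun w => (N w).strands) : IsLocalRelation a c (placePoly N u)

theorem lmapDomain_placePoly (F : FreeMonoid S → Cob S X Y) (g : Cob S X Y → Cob S X' Y')
    (u : NCPoly K S) :
    Finsupp.lmapDomain K K g (placePoly F u) = placePoly (fun w => g (F w)) u := by
  simp only [placePoly, LinearMap.comp_apply, Finsupp.lmapDomain_apply]
  exact (Finsupp.mapDomain_comp).symm

/-- An operation on cobordisms that is compatible with the local relations. -/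
structure IsLocalOperation (a c : FreeMonoid S → K) (g : Cob S X Y → Cob S X' Y') : Prop where
  interval : ∀ N N' w, N.strands = .arc none none w ::ₘ N'.strands →
    (g N).strands = .arc none none w ::ₘ (g N').strands
  circle : ∀ N N' w, N.strands = .circle w ::ₘ N'.strands →
    (g N).strands = .circle w ::ₘ (g N').strands
  family : ∀ (u : NCPoly K S) (N : FreeMonoid S → Cob S X Y), IsNullFamily a c u (fun w => (N w).strands) →
    IsNullFamily a c u (fun w => (g (N w)).strands)

variable {a c : FreeMonoid S → K}

/-- Composition and tensor product with a fixed cobordism are such operations, so the span of the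
local relations is closed under everything that generates the skein ideal. -/
theorem IsLocalOperation.map_mem {g : Cob S X Y → Cob S X' Y'} (hg : IsLocalOperation a c g)
    {x : LinCob K S X Y} (hx : x ∈ Submodule.span K {x | IsLocalRelation a c x}) :
    Finsupp.lmapDomain K K g x ∈ Submodule.span K {x | IsLocalRelation a c x} := by
  refine (Submodule.map_span_le _ _ _).2 ?_ (Submodule.mem_map_of_mem hx)
  rintro _ (⟨N, N', w, h⟩ | ⟨N, N', w, h⟩ | ⟨N, u, h⟩)
  · refine Submodule.subset_span ?_
    rw [map_sub, map_smul, Finsupp.lmapDomain_apply, Finsupp.lmapDomain_apply,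
      Finsupp.mapDomain_single, Finsupp.mapDomain_single]
    exact .interval _ _ w (hg.interval _ _ _ h)
  · refine Submodule.subset_span ?_
    rw [map_sub, map_smul, Finsupp.lmapDomain_apply, Finsupp.lmapDomain_apply,
      Finsupp.mapDomain_single, Finsupp.mapDomain_single]
    exact .circle _ _ w (hg.circle _ _ _ h)
  · refine Submodule.subset_span ?_
    rw [lmapDomain_placePoly]
    exact .family _ u (hg.family u N h)

theorem nodup_middle (X Y Z : SignSeq) : (Cob.middle X Y Z).Nodup :=
  (List.nodup_finRange _).map fun i j h => by simpa using h

theorem countP_src_middle (M : Cob S X Y) (N : Cob S Y Z) :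
    ∀ z ∈ Cob.middle X Y Z, (Cob.stack M N).countP (fun p => p.src = some z) = 1 := by
  intro z hz
  obtain ⟨j, -, rfl⟩ := List.mem_map.1 hz
  exact ((Cob.countP_stack M N).2.1 j).1

theorem countP_tgt_middle (M : Cob S X Y) (N : Cob S Y Z) :
    ∀ z ∈ Cob.middle X Y Z, (Cob.stack M N).countP (fun p => p.tgt = some z) = 1 := by
  intro z hz
  obtain ⟨j, -, rfl⟩ := List.mem_map.1 hz
  exact ((Cob.countP_stack M N).2.1 j).2

theorem isLocalOperation_comp_below (M : Cob S X Y) :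
    IsLocalOperation a c (fun N : Cob S Y Z => M.comp N) where
  interval N N' w h := by
    simp only [Cob.comp, Cob.stack, h, Multiset.map_cons, Multiset.add_cons]
    rw [foldr_glue_cons_of_ne _ _ _ (by simp [Strand.relabel, Strand.src])
      (by simp [Strand.relabel, Strand.tgt]), Multiset.map_cons]
    rfl
  circle N N' w h := by
    simp only [Cob.comp, Cob.stack, h, Multiset.map_cons, Multiset.add_cons]
    rw [foldr_glue_cons_of_ne _ _ _ (by simp [Strand.relabel, Strand.src])
      (by simp [Strand.relabel, Strand.tgt]), Multiset.map_cons]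
    rfl
  family u N h := by
    refine IsNullFamily.relabel (IsNullFamily.foldr_glue ?_ _ (nodup_middle X Y Z)
      (fun w => countP_src_middle M (N w)) (fun w => countP_tgt_middle M (N w))) _
    simp only [Cob.stack, add_comm (M.strands.map _)]
    exact (h.relabel _).add _

theorem isLocalOperation_comp_above (N : Cob S Y Z) :
    IsLocalOperation a c (fun M : Cob S X Y => M.comp N) where
  interval M M' w h := by
    simp only [Cob.comp, Cob.stack, h, Multiset.map_cons, Multiset.cons_add]
    rw [foldr_glue_cons_of_ne _ _ _ (by simp [Strand.relabel, Strand.src])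
      (by simp [Strand.relabel, Strand.tgt]), Multiset.map_cons]
    rfl
  circle M M' w h := by
    simp only [Cob.comp, Cob.stack, h, Multiset.map_cons, Multiset.cons_add]
    rw [foldr_glue_cons_of_ne _ _ _ (by simp [Strand.relabel, Strand.src])
      (by simp [Strand.relabel, Strand.tgt]), Multiset.map_cons]
    rfl
  family u M h := IsNullFamily.relabel (IsNullFamily.foldr_glue ((h.relabel _).add _) _
    (nodup_middle X Y Z) (fun w => countP_src_middle (M w) N)
    (fun w => countP_tgt_middle (M w) N)) _

theorem isLocalOperation_tensor_left (M : Cob S X Y) :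
    IsLocalOperation a c (fun N : Cob S X' Y' => M.tensor N) where
  interval N N' w h := by
    simp only [Cob.tensor, Cob.beside, h, Multiset.map_cons, Multiset.add_cons]
    rfl
  circle N N' w h := by
    simp only [Cob.tensor, Cob.beside, h, Multiset.map_cons, Multiset.add_cons]
    rfl
  family u N h := by
    simp only [Cob.tensor, Cob.beside, add_comm (M.strands.map _)]
    exact (h.relabel _).add _

theorem isLocalOperation_tensor_right (N : Cob S X' Y') :
    IsLocalOperation a c (fun M : Cob S X Y => M.tensor N) where
  interval M M' w h := by
    simp only [Cob.tensor, Cob.beside, h, Multiset.map_cons, Multiset.cons_add]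
    rfl
  circle M M' w h := by
    simp only [Cob.tensor, Cob.beside, h, Multiset.map_cons, Multiset.cons_add]
    rfl
  family u M h := (h.relabel _).add _

/-- A linear combination that vanishes in the skein category is a sum of local relations. -/
theorem IsSkeinZero.mem_span {x : LinCob K S X Y} (hx : IsSkeinZero a c x) :
    x ∈ Submodule.span K {x | IsLocalRelation a c x} := by
  induction hx with
  | floatingInterval w => exact Submodule.subset_span (.interval _ _ w rfl)
  | floatingCircle w => exact Submodule.subset_span (.circle _ _ w rfl)
  -- In a generating relation the inserted word is the whole word of the only component, so the
  -- surrounding words `v` and `v'` are empty and no further components are present.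
  | through u hu =>
    exact Submodule.subset_span (.family _ u ⟨_, 0, Or.inl ⟨_, _, 1, 1,
      fun w => by rw [one_mul, mul_one], by
        rw [← MonoidAlgebra.one_def, one_mul, mul_one]; exact hu⟩,
      fun w => rfl⟩)
  | fromFloating u hu =>
    exact Submodule.subset_span (.family _ u ⟨_, 0, Or.inl ⟨_, _, 1, 1,
      fun w => by rw [one_mul, mul_one], by
        rw [← MonoidAlgebra.one_def, one_mul, mul_one]; exact hu⟩,
      fun w => rfl⟩)
  | toFloating u hu =>
    exact Submodule.subset_span (.family _ u ⟨_, 0, Or.inl ⟨_, _, 1, 1,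
      fun w => by rw [one_mul, mul_one], by
        rw [← MonoidAlgebra.one_def, one_mul, mul_one]; exact hu⟩,
      fun w => rfl⟩)
  | zero => exact zero_mem _
  | add x y _ _ hx hy => exact add_mem hx hy
  | smul r x _ hx => exact Submodule.smul_mem _ r hx
  | comp_below M x _ hx => exact (isLocalOperation_comp_below M).map_mem hx
  | comp_above x N _ hx => exact (isLocalOperation_comp_above N).map_mem hx
  | tensor_left M x _ hx => exact (isLocalOperation_tensor_left M).map_mem hx
  | tensor_right x N _ hx => exact (isLocalOperation_tensor_right N).map_mem hx

end Relations

/-! ### Multiplicative evaluation of cobordisms in a commutative algebra. -/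

section Evaluation

/-- A rotation of a word exchanges two consecutive parts of it, so symmetry makes the series a
function on cycles. It supplies the values of circles. -/
theorem IsSymmetricSeries.exists_cycle {K S : Type*} {c : FreeMonoid S → K} (hc : IsSymmetricSeries c) :
    ∃ e : Cycle S → K, ∀ w : FreeMonoid S, e (w.toList : Cycle S) = c w := by
  refine ⟨Quotient.lift (fun l => c (FreeMonoid.ofList l)) ?_, fun w => rfl⟩
  rintro l _ ⟨n, rfl⟩
  rw [List.rotate_eq_drop_append_take_mod, FreeMonoid.ofList_append, hc, ← FreeMonoid.ofList_append,
    List.take_append_drop]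

variable {K S L R : Type*} [Field K] [CommRing R] [Algebra K R]

/-- The value of a component, for given values of decorated intervals and circles. -/
noncomputable def Strand.eval (e : Cycle S → K) (θ : Option L → Option L → NCPoly K S →ₗ[K] R) :
    Strand S L → R
  | .arc s t w => θ s t (MonoidAlgebra.single w 1)
  | .circle w => algebraMap K R (e w)

/-- The multiplicative evaluation of cobordisms, extended linearly. -/
noncomputable def cobEval {X Y : SignSeq} (e : Cycle S → K)
    (θ : Option (BdPt X Y) → Option (BdPt X Y) → NCPoly K S →ₗ[K] R) : LinCob K S X Y →ₗ[K] R :=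
  Finsupp.linearCombination K fun N => (N.strands.map (Strand.eval e θ)).prod

variable {X Y : SignSeq} {e : Cycle S → K}
  {θ : Option (BdPt X Y) → Option (BdPt X Y) → NCPoly K S →ₗ[K] R} {a c : FreeMonoid S → K}

theorem cobEval_single (N : Cob S X Y) (r : K) :
    cobEval e θ (Finsupp.single N r) = r • (N.strands.map (Strand.eval e θ)).prod :=
  Finsupp.linearCombination_single K r N

theorem placePoly_single (F : FreeMonoid S → Cob S X Y) (w : FreeMonoid S) (r : K) :
    placePoly F (MonoidAlgebra.single w r) = Finsupp.single (F w) r :=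
  Finsupp.mapDomain_single

/-- A local relation affects only one factor of the product over the components. In the third case
the value is a linear function of `u`, namely the value of `v * u * v'` on that component times a
constant; it is enough to compare the two on words. -/
theorem IsLocalRelation.cobEval_eq_zero (he : ∀ w : FreeMonoid S, e (w.toList : Cycle S) = c w)
    (hθ : ∀ s t, ∀ u ∈ arcIdeal a c s t, θ s t u = 0)
    (hθ' : ∀ u, θ none none u = algebraMap K R (seriesEval a u)) {x : LinCob K S X Y}
    (hx : IsLocalRelation a c x) : cobEval e θ x = 0 := by
  obtain ⟨N, N', w, h⟩ | ⟨N, N', w, h⟩ | ⟨N, u, P, D, hP, hN⟩ := hx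
  · rw [map_sub, map_smul, cobEval_single, cobEval_single, h, Multiset.map_cons,
      Multiset.prod_cons, Strand.eval, hθ', seriesEval_single, Algebra.smul_def (a w),
      one_smul, one_smul, sub_self]
  · rw [map_sub, map_smul, cobEval_single, cobEval_single, h, Multiset.map_cons,
      Multiset.prod_cons, Strand.eval, he, Algebra.smul_def (c w), one_smul, one_smul, sub_self]
  · have hw : ∀ w, cobEval e θ (placePoly N (MonoidAlgebra.single w 1)) =
        (P w).eval e θ * (D.map (Strand.eval e θ)).prod := fun w => by
      rw [placePoly_single, cobEval_single, one_smul, show (N w).strands = _ from hN w, Multiset.map_cons, Multiset.prod_cons]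
    obtain ⟨s, t, v, v', hP, hu⟩ | ⟨v, v', hP, hu⟩ := hP
    · have key : (cobEval e θ).comp (placePoly N) =
          ((LinearMap.mulRight K (D.map (Strand.eval e θ)).prod).comp (θ s t)).comp
            ((LinearMap.mulRight K (MonoidAlgebra.single v' 1)).comp
              (LinearMap.mulLeft K (MonoidAlgebra.single v 1))) := by
        refine MonoidAlgebra.lhom_ext' fun w => LinearMap.ext_ring ?_
        refine (hw w).trans ?_
        simp [hP, Strand.eval, MonoidAlgebra.single_mul_single]
      refine (LinearMap.congr_fun key u).trans ?_
      simp [hθ s t _ hu]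
    · have key : (cobEval e θ).comp (placePoly N) =
          ((LinearMap.mulRight K (D.map (Strand.eval e θ)).prod).comp
            ((Algebra.linearMap K R).comp (seriesEval c))).comp
            ((LinearMap.mulRight K (MonoidAlgebra.single v' 1)).comp
              (LinearMap.mulLeft K (MonoidAlgebra.single v 1))) := by
        refine MonoidAlgebra.lhom_ext' fun w => LinearMap.ext_ring ?_
        refine (hw w).trans ?_
        simp only [hP, Strand.eval, he]
        simp [MonoidAlgebra.single_mul_single, seriesEval_single, -map_mul, -FreeMonoid.toList_mul]
      refine (LinearMap.congr_fun key u).trans ?_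
      simp only [LinearMap.comp_apply, LinearMap.mulLeft_apply, LinearMap.mulRight_apply, hu,
        map_zero]

theorem skeinIdeal_le_ker_cobEval (he : ∀ w : FreeMonoid S, e (w.toList : Cycle S) = c w)
    (hθ : ∀ s t, ∀ u ∈ arcIdeal a c s t, θ s t u = 0)
    (hθ' : ∀ u, θ none none u = algebraMap K R (seriesEval a u)) :
    skeinIdeal a c X Y ≤ LinearMap.ker (cobEval e θ) := fun _ hx =>
  Submodule.span_le.2 (fun _ hy => IsLocalRelation.cobEval_eq_zero he hθ hθ' hy)
    (IsSkeinZero.mem_span hx)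

theorem LinearMap.apply_eq_sum_coeff {M : Type*} [AddCommGroup M] [Module K M]
    (f : NCPoly K S →ₗ[K] M) (u : NCPoly K S) :
    f u = ∑ w ∈ u.coeff.support, u.coeff w • f (MonoidAlgebra.single w 1) := by
  conv_lhs => rw [← MonoidAlgebra.sum_coeff_single u, Finsupp.sum, map_sum]
  refine Finset.sum_congr rfl fun w _ => ?_
  rw [← map_smul, MonoidAlgebra.smul_single, smul_eq_mul, mul_one]

/-- The multilinear expansion of the polynomials matches the expansion of a product of sums. -/
theorem cobEval_decoratePoly (x : ViewableCob X Y) (d : x.arcs → NCPoly K S) :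
    cobEval e θ (x.decoratePoly d) = ∏ p, θ p.1.1 p.1.2 (d p) := by
  simp only [fun p : x.arcs => LinearMap.apply_eq_sum_coeff (θ p.1.1 p.1.2) (d p),
    Finset.prod_univ_sum, ViewableCob.decoratePoly, map_sum, cobEval_single]
  refine Finset.sum_congr rfl fun w _ => ?_
  rw [ViewableCob.decorate, Multiset.map_map, Finset.prod_smul]
  rfl

end Evaluation

/-! ### Linear independence through distinct monomials. -/

section Independence

variable {K S : Type*} [Field K] {X Y : SignSeq}

/-- The monomial with one variable for each component of a viewable cobordism with polynomials. -/
noncomputable def BasicCob.exponent {B Bl Br : Set (NCPoly K S)} (x : BasicCob B Bl Br X Y) :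
    (Option (BdPt X Y) × Option (BdPt X Y)) × NCPoly K S →₀ ℕ :=
  ∑ p : x.1.arcs, Finsupp.single (p.1, (x.2 p : NCPoly K S)) 1

theorem BasicCob.mem_support_exponent {B Bl Br : Set (NCPoly K S)} (x : BasicCob B Bl Br X Y)
    (q : (Option (BdPt X Y) × Option (BdPt X Y)) × NCPoly K S) :
    x.exponent q ≠ 0 ↔ ∃ p : x.1.arcs, (p.1, (x.2 p : NCPoly K S)) = q := by
  classical
  simp [exponent, Finsupp.finsetSum_apply, Finsupp.single_apply]

/-- The variables that occur in the monomial are the endpoint pairs of the components with their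
polynomials. The components form a set of endpoint pairs, so this determines both the cobordism and
its decoration. -/
theorem BasicCob.exponent_injective (B Bl Br : Set (NCPoly K S)) :
    Function.Injective (BasicCob.exponent : BasicCob B Bl Br X Y → _) := by
  rintro ⟨x, d⟩ ⟨y, d'⟩ h
  have key : ∀ q, (∃ p : x.arcs, (p.1, (d p : NCPoly K S)) = q) ↔
      ∃ p : y.arcs, (p.1, (d' p : NCPoly K S)) = q := fun q => by
    rw [← mem_support_exponent ⟨x, d⟩, ← mem_support_exponent ⟨y, d'⟩, h]
  obtain rfl : x = y := by
    refine ViewableCob.ext (Finset.ext fun p => ⟨fun hp => ?_, fun hp => ?_⟩)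
    · obtain ⟨p', hp'⟩ := (key _).1 ⟨⟨p, hp⟩, rfl⟩
      obtain rfl : p'.1 = p := (Prod.ext_iff.1 hp').1
      exact p'.2
    · obtain ⟨p', hp'⟩ := (key _).2 ⟨⟨p, hp⟩, rfl⟩
      obtain rfl : p'.1 = p := (Prod.ext_iff.1 hp').1
      exact p'.2
  congr 1
  funext p
  obtain ⟨p', hp'⟩ := (key _).1 ⟨p, rfl⟩
  obtain ⟨h1, h2⟩ := Prod.ext_iff.1 hp'
  obtain rfl : p' = p := Subtype.ext h1
  exact Subtype.ext h2.symm

theorem linearIndependent_toSkeinHom (a c : FreeMonoid S → K) (hsymm : IsSymmetricSeries c)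
    (B Bl Br : Set (NCPoly K S)) (hB : DescendsToBasis (pairSyntactic a c) B)
    (hBl : DescendsToBasis (leftSyntactic a) Bl) (hBr : DescendsToBasis (rightSyntactic a) Br) :
    LinearIndependent K
      (fun x : BasicCob B Bl Br X Y => (x.toSkeinHom a c : SkeinHom a c X Y)) := by
  obtain ⟨e, he⟩ := hsymm.exists_cycle
  let R := MvPolynomial ((Option (BdPt X Y) × Option (BdPt X Y)) × NCPoly K S) K
  -- For a floating interval the value is forced to be that of `a`. For every other pair of
  -- endpoints the values on the allowed polynomials are free, since these represent a basis of the
  -- quotient by `arcIdeal`.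
  have hθ : ∀ p : Option (BdPt X Y) × Option (BdPt X Y), ∃ θ : NCPoly K S →ₗ[K] R,
      (∀ u ∈ arcIdeal a c p.1 p.2, θ u = 0) ∧
      (p = (none, none) → ∀ u, θ u = algebraMap K R (seriesEval a u)) ∧
      ∀ b ∈ allowed B Bl Br p, θ b = MvPolynomial.X (p, b) := by
    intro p
    by_cases hp : p = (none, none)
    · subst hp
      exact ⟨(Algebra.linearMap K R).comp (seriesEval a),
        fun u hu => by rw [LinearMap.comp_apply, LinearMap.mem_ker.1 hu, map_zero],
        fun _ u => rfl, fun b hb => hb.elim⟩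
    · obtain ⟨θ, h1, h2⟩ := (allowed_descendsToBasis hB hBl hBr p hp).exists_linearMap
        (fun b => (MvPolynomial.X (p, b) : R))
      exact ⟨θ, h1, fun h => absurd h hp, h2⟩
  choose θ h1 h2 h3 using hθ
  let E : SkeinHom a c X Y →ₗ[K] R := (skeinIdeal a c X Y).liftQ
    (cobEval e fun s t => θ (s, t))
    (skeinIdeal_le_ker_cobEval he (fun s t => h1 (s, t)) (h2 (none, none) rfl))
  refine LinearIndependent.of_comp E ?_
  have hE : (E ∘ fun x : BasicCob B Bl Br X Y => x.toSkeinHom a c) =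
      (MvPolynomial.basisMonomials _ K) ∘ BasicCob.exponent := by
    funext x
    refine (cobEval_decoratePoly x.1 _).trans ?_
    rw [Function.comp_apply, MvPolynomial.coe_basisMonomials, BasicCob.exponent]
    refine Eq.trans ?_ (MvPolynomial.monomial_sum_one _ _).symm
    exact Finset.prod_congr rfl fun p _ => h3 p.1 _ (x.2 p).2
  rw [hE]
  exact (MvPolynomial.basisMonomials _ K).linearIndependent.comp _
    (BasicCob.exponent_injective B Bl Br)

end Independence

/-! ### Identity intervals are absorbed by gluing. -/

section Identities

variable {S L L' L'' : Type*}

theorem Strand.relabel_congr {f g : L → Option L'} (p : Strand S L)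
    (h1 : ∀ x, p.src = some x → f x = g x) (h2 : ∀ x, p.tgt = some x → f x = g x) :
    p.relabel f = p.relabel g := by
  rcases p with ⟨s, t, w⟩ | w
  · exact congrArg₂ (fun s t => Strand.arc s t w) (Option.bind_congr h1) (Option.bind_congr h2)
  · rfl

theorem Strand.relabel_some (p : Strand S L) : p.relabel some = p := by
  rcases p with ⟨s, t, w⟩ | w <;> simp [Strand.relabel]

theorem Strand.relabel_relabel (f : L → Option L') (g : L' → Option L'') (p : Strand S L) :
    (p.relabel f).relabel g = p.relabel fun x => (f x).bind g := by
  rcases p with ⟨s, t, w⟩ | w <;> simp [Strand.relabel, Option.bind_assoc]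

/-- Gluing an interval without dots amounts to a change of labels. -/
theorem glue_cons_id_src [DecidableEq L] {z y : L} (D : Multiset (Strand S L))
    (h1 : D.countP (fun p => p.src = some z) = 1) (h2 : D.countP (fun p => p.tgt = some z) = 0)
    (hyz : y ≠ z) (f : L → Option L') (hf : f y = f z) :
    (glue z (.arc (some y) (some z) 1 ::ₘ D)).map (Strand.relabel f) =
      D.map (Strand.relabel f) := by
  obtain ⟨q, hq, hqz⟩ := Multiset.countP_pos.1 (h1.symm ▸ one_pos)
  obtain ⟨R, rfl⟩ := Multiset.exists_cons_of_mem hq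
  rw [countP_src_cons, if_pos hqz] at h1
  have h1' := Multiset.countP_eq_zero.1 (Nat.succ_injective h1)
  have h2' := Multiset.countP_eq_zero.1 h2
  rw [glue_eq_join z R (fun p hp => ⟨h1' p hp, h2' p (Multiset.mem_cons_of_mem hp)⟩) _ q
    (by simpa using hyz) rfl hqz (h2' q hq), Multiset.map_cons, Multiset.map_cons]
  rcases q with ⟨s, t, w⟩ | w
  · rw [Strand.src_arc] at hqz
    subst hqz
    simp [Strand.join, Strand.relabel, Strand.word, hf]
  · simp [Strand.src] at hqz

theorem glue_cons_id_tgt [DecidableEq L] {z y : L} (D : Multiset (Strand S L))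
    (h1 : D.countP (fun p => p.src = some z) = 0) (h2 : D.countP (fun p => p.tgt = some z) = 1)
    (hyz : y ≠ z) (f : L → Option L') (hf : f y = f z) :
    (glue z (.arc (some z) (some y) 1 ::ₘ D)).map (Strand.relabel f) =
      D.map (Strand.relabel f) := by
  obtain ⟨q, hq, hqz⟩ := Multiset.countP_pos.1 (h2.symm ▸ one_pos)
  obtain ⟨R, rfl⟩ := Multiset.exists_cons_of_mem hq
  rw [countP_tgt_cons, if_pos hqz] at h2
  have h1' := Multiset.countP_eq_zero.1 h1
  have h2' := Multiset.countP_eq_zero.1 (Nat.succ_injective h2)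
  rw [Multiset.cons_swap, glue_eq_join z R
    (fun p hp => ⟨h1' p (Multiset.mem_cons_of_mem hp), h2' p hp⟩) q _
    (h1' q hq) hqz rfl (by simpa using hyz), Multiset.map_cons, Multiset.map_cons]
  rcases q with ⟨s, t, w⟩ | w
  · rw [Strand.tgt_arc] at hqz
    subst hqz
    simp [Strand.join, Strand.relabel, Strand.word, hf]
  · simp [Strand.tgt] at hqz

/-- Intervals without dots between the labels `bot i` and `mid i`. -/
def idStrands {ι : Type*} (bot mid : ι → L) (sg : ι → Bool) (l : List ι) :
    Multiset (Strand S L) :=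
  (l.map fun i => Strand.arc (some (if sg i then bot i else mid i))
    (some (if sg i then mid i else bot i)) 1 : List (Strand S L))

theorem idStrands_cons {ι : Type*} (bot mid : ι → L) (sg : ι → Bool) (i : ι) (l : List ι) :
    (idStrands bot mid sg (i :: l) : Multiset (Strand S L)) =
      .arc (some (if sg i then bot i else mid i)) (some (if sg i then mid i else bot i)) 1 ::ₘ
        idStrands bot mid sg l := rfl

/-- Gluing an identity interval onto the component that ends or starts at `mid i` only renames that
label to `bot i`, and `f` does not distinguish the two. The counts guarantee exactly one such
component, also after the other points have been glued. -/
theorem foldr_glue_idStrands [DecidableEq L] {ι : Type*} (bot mid : ι → L) (sg : ι → Bool)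
    (hmid : Function.Injective mid) (hbot : ∀ i j, bot i ≠ mid j) (f : L → Option L')
    (hf : ∀ i, f (bot i) = f (mid i)) (l : List ι) (hl : l.Nodup) (D : Multiset (Strand S L))
    (h1 : ∀ i ∈ l, (idStrands bot mid sg l + D : Multiset (Strand S L)).countP
        (fun p => p.src = some (mid i)) = 1)
    (h2 : ∀ i ∈ l, (idStrands bot mid sg l + D : Multiset (Strand S L)).countP
        (fun p => p.tgt = some (mid i)) = 1) :
    ((l.map mid).foldr glue (idStrands bot mid sg l + D)).map
        (Strand.relabel f) = D.map (Strand.relabel f) := by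
  induction l with
  | nil => simp [idStrands]
  | cons i l ih =>
    rw [List.nodup_cons] at hl
    rw [idStrands_cons, Multiset.cons_add] at h1 h2 ⊢
    have hne : ∀ j ∈ l, mid i ≠ mid j := fun j hj h => hl.1 (hmid h ▸ hj)
    have k1 := fun j hj => (countP_src_cons _ _ _).symm.trans (h1 j hj)
    have k2 := fun j hj => (countP_tgt_cons _ _ _).symm.trans (h2 j hj)
    have hs : ∀ j ∈ l, ¬ (some (if sg i then bot i else mid i) = some (mid j)) := fun j hj => by
      split_ifs <;> simp [hbot, hne j hj]
    have ht : ∀ j ∈ l, ¬ (some (if sg i then mid i else bot i) = some (mid j)) := fun j hj => by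
      split_ifs <;> simp [hbot, hne j hj]
    have k1' : ∀ j ∈ l, _ := fun j hj => by
      have := k1 j (List.mem_cons_of_mem _ hj)
      rwa [Strand.src_arc, if_neg (hs j hj), add_zero] at this
    have k2' : ∀ j ∈ l, _ := fun j hj => by
      have := k2 j (List.mem_cons_of_mem _ hj)
      rwa [Strand.tgt_arc, if_neg (ht j hj), add_zero] at this
    rw [← ih hl.2 k1' k2', List.map_cons, List.foldr_cons, foldr_glue_cons_of_ne _ _ _
      (by simpa using hs) (by simpa using ht)]
    have m1 := k1 i List.mem_cons_self
    have m2 := k2 i List.mem_cons_self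
    have hg := countP_foldr_glue _ (l.map mid) (hl.2.map hmid)
      (List.forall_mem_map.2 k1') (List.forall_mem_map.2 k2') (mid i)
    have hi : mid i ∉ l.map mid := by simpa using fun j hj h => hne j hj h.symm
    rw [if_neg hi, if_neg hi] at hg
    rw [Strand.src_arc, ← hg.1] at m1
    rw [Strand.tgt_arc, ← hg.2] at m2
    cases hi : sg i
    · simp only [hi, Bool.false_eq_true, if_false, if_true, Option.some.injEq, hbot] at m1 m2 ⊢
      exact glue_cons_id_tgt _ (Nat.succ_injective m1) m2 (hbot i i) f (hf i)
    · simp only [hi, if_false, if_true, Option.some.injEq, hbot] at m1 m2 ⊢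
      exact glue_cons_id_src _ m1 (Nat.succ_injective m2) (hbot i i) f (hf i)

theorem List.finRange_add (m n : ℕ) : List.finRange (m + n) =
    (List.finRange m).map (Fin.castAdd n) ++ (List.finRange n).map (Fin.natAdd m) := by
  rw [← List.ofFn_id, List.ofFn_add, List.ofFn_eq_map, List.ofFn_eq_map]
  rfl

end Identities

/-! ### Inserting a cobordism from the empty sequence into a fixed one. -/

section Plugging

variable {K S : Type*} [Field K] {X Y E : SignSeq} {a c : FreeMonoid S → K}

theorem SignSeq.sign_append_empty (X : SignSeq) :
    (X.append SignSeq.empty).sign = X.sign := Fin.append_elim0 X.sign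

/-- Removal of the empty sequence from the source of a cobordism. -/
def Cob.ofAppendEmpty (N : Cob S (X.append SignSeq.empty) Y) : Cob S X Y where
  strands := N.strands
  starts b := by
    have h := N.starts b
    rw [isStart, SignSeq.sign_append_empty] at h
    exact h
  ends b := by
    have h := N.ends b
    rw [isStart, SignSeq.sign_append_empty] at h
    exact h

theorem isSkeinZero_ofAppendEmpty {x : LinCob K S (X.append SignSeq.empty) Y}
    (hx : IsSkeinZero a c x) : IsSkeinZero a c (Finsupp.lmapDomain K K Cob.ofAppendEmpty x) := by
  -- The sequences `X.append SignSeq.empty` and `X` have definitionally equal lengths, but their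
  -- signs are only propositionally equal. With the signs generalized, the equality can be
  -- substituted, and the map becomes the identity.
  have key : ∀ {n : ℕ} {s s' : Fin n → Bool} (_ : s = s')
      (g : Cob S ⟨n, s⟩ Y → Cob S ⟨n, s'⟩ Y) (_ : ∀ N, (g N).strands = N.strands)
      {x : LinCob K S ⟨n, s⟩ Y} (_ : IsSkeinZero a c x),
      IsSkeinZero a c (Finsupp.lmapDomain K K g x) := by
    rintro n s _ rfl g hg x hx
    obtain rfl : g = _root_.id := funext fun N => Cob.ext (hg N)
    rwa [Finsupp.lmapDomain_id, LinearMap.id_apply]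
  exact key X.sign_append_empty _ (fun _ => rfl) hx

/-- Place `F` to the right of the identity of `X`, below `M`. -/
def Cob.plug (M : Cob S (X.append E) Y) (F : Cob S SignSeq.empty E) : Cob S X Y :=
  (((Cob.id S X).tensor F).comp M).ofAppendEmpty

theorem isSkeinZero_plug (M : Cob S (X.append E) Y) {x : LinCob K S SignSeq.empty E}
    (hx : IsSkeinZero a c x) : IsSkeinZero a c (Finsupp.lmapDomain K K M.plug x) := by
  have := isSkeinZero_ofAppendEmpty
    (IsSkeinZero.comp_above _ M (IsSkeinZero.tensor_left (Cob.id S X) x hx))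
  simp only [Finsupp.lmapDomain_apply, ← Finsupp.mapDomain_comp] at this ⊢
  exact this

variable (X Y E) in
/-- The labels for the composition that defines `Cob.plug`. -/
abbrev PlugLabel := Fin (X.append SignSeq.empty).len ⊕ Fin (X.append E).len ⊕ Fin Y.len

variable (X Y E) in
/-- The labels of the points of `E`. -/
def plugPoint (k : Fin E.len) : PlugLabel X Y E := .inr (.inl (X.inRight E k))

variable (X Y E) in
/-- The inclusion of boundary points of `X` and `Y` into those of `X ⊗ E` and `Y`. -/
def keepLabel : BdPt X Y → Option (BdPt (X.append E) Y)
  | .inl i => some (.inl (X.inLeft E i))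
  | .inr k => some (.inr k)

variable (X Y E) in
/-- The labels that remain after gluing. -/
def plugLabel : PlugLabel X Y E → Option (BdPt X Y)
  | .inl i => some (.inl i)
  | .inr (.inl j) => Fin.addCases (fun i => some (.inl i)) (fun _ => none) j
  | .inr (.inr k) => some (.inr k)

@[simp] theorem plugLabel_inLeft (i : Fin X.len) :
    plugLabel X Y E (.inr (.inl (X.inLeft E i))) = some (.inl i) :=
  Fin.addCases_left (m := X.len) (n := E.len) (motive := fun _ => Option (BdPt X Y))
    (left := fun i => some (.inl i)) (right := fun _ => none) i

theorem id_strands (X : SignSeq) : (Cob.id S X).strands =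
    idStrands Sum.inl Sum.inr X.sign (List.finRange X.len) := rfl

theorem plugLabel_upper_keep (b : BdPt X Y) :
    ((keepLabel X Y E b).bind (Cob.upperLabel (X.append SignSeq.empty) (X.append E) Y)).bind
      (plugLabel X Y E) = some b := by
  rcases b with i | k
  · exact plugLabel_inLeft i
  · rfl

theorem keep_upper_ne_plugPoint (b : BdPt X Y) (k : Fin E.len) :
    (keepLabel X Y E b).bind (Cob.upperLabel (X.append SignSeq.empty) (X.append E) Y) ≠
      some (plugPoint X Y E k) := by
  rcases b with i | i <;> simp [keepLabel, Cob.upperLabel, plugPoint]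

/-- The components of `F` and a part `P` of those of `M` about to be glued. -/
def plugStack (F : Multiset (Strand S (BdPt SignSeq.empty E)))
    (P : Multiset (Strand S (BdPt (X.append E) Y))) : Multiset (Strand S (PlugLabel X Y E)) :=
  F.map (Strand.relabel fun b => (Cob.rightLabel X X SignSeq.empty E b).bind
    (Cob.lowerLabel (X.append SignSeq.empty) (X.append E) Y)) +
  P.map (Strand.relabel (Cob.upperLabel (X.append SignSeq.empty) (X.append E) Y))

theorem stack_id_tensor (M : Cob S (X.append E) Y) (F : Cob S SignSeq.empty E) :
    Cob.stack ((Cob.id S X).tensor F) M =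
      idStrands (fun i => Sum.inl (X.inLeft SignSeq.empty i))
        (fun i => Sum.inr (Sum.inl (X.inLeft E i))) X.sign (List.finRange X.len) +
      plugStack F.strands M.strands := by
  change Multiset.map _ (Multiset.map _ (Cob.id S X).strands + Multiset.map _ F.strands) + _ = _
  rw [Multiset.map_add, Multiset.map_map, Multiset.map_map, id_strands, add_assoc, plugStack]
  congr 1
  · rw [idStrands, idStrands, Multiset.map_coe, List.map_map]
    refine congrArg _ (List.map_congr_left fun i _ => ?_)
    cases h : X.sign i <;> simp [h, Strand.relabel, Cob.leftLabel, Cob.lowerLabel]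
  · congr 1
    exact Multiset.map_congr rfl fun p _ => Strand.relabel_relabel _ _ p

theorem middle_append : Cob.middle (X.append SignSeq.empty) (X.append E) Y =
    (List.finRange X.len).map (fun i => Sum.inr (Sum.inl (X.inLeft E i))) ++
      (List.finRange E.len).map (plugPoint X Y E) := by
  refine (congrArg (List.map fun j => (Sum.inr (Sum.inl j) : PlugLabel X Y E))
    (List.finRange_add X.len E.len)).trans (List.map_append.trans ?_)
  exact congrArg₂ _ List.map_map List.map_map

theorem plug_strands_eq (M : Cob S (X.append E) Y) (F : Cob S SignSeq.empty E) :
    (M.plug F).strands = (((List.finRange E.len).map (plugPoint X Y E)).foldr glue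
      (plugStack F.strands M.strands)).map (Strand.relabel (plugLabel X Y E)) := by
  have n := nodup_middle (X.append SignSeq.empty) (X.append E) Y
  have c1 := countP_src_middle ((Cob.id S X).tensor F) M
  have c2 := countP_tgt_middle ((Cob.id S X).tensor F) M
  have c3 := countP_foldr_glue _ _ n c1 c2
  have e : (M.plug F).strands = ((Cob.middle (X.append SignSeq.empty) (X.append E) Y).foldr glue
      (Cob.stack ((Cob.id S X).tensor F) M)).map (Strand.relabel (plugLabel X Y E)) := by
    -- The composition relabels by `outerLabel`, which differs from `plugLabel` only on middle
    -- labels; none of these survives the gluing. With `plugLabel`, a middle label over `X` and the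
    -- bottom label below it have the same image, as `foldr_glue_idStrands` requires.
    refine Multiset.map_congr rfl fun p hp => Strand.relabel_congr p ?_ ?_
    · rintro (i | j | k) hx
      · rfl
      · have hm : .inr (.inl j) ∈ Cob.middle (X.append SignSeq.empty) (X.append E) Y :=
          List.mem_map_of_mem (List.mem_finRange j)
        have := (c3 (.inr (.inl j))).1
        rw [if_pos hm] at this
        exact absurd hx (Multiset.countP_eq_zero.1 this p hp)
      · rfl
    · rintro (i | j | k) hx
      · rfl
      · have hm : .inr (.inl j) ∈ Cob.middle (X.append SignSeq.empty) (X.append E) Y :=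
          List.mem_map_of_mem (List.mem_finRange j)
        have := (c3 (.inr (.inl j))).2
        rw [if_pos hm] at this
        exact absurd hx (Multiset.countP_eq_zero.1 this p hp)
      · rfl
  rw [e]
  rw [middle_append] at n c1 c2 ⊢
  rw [stack_id_tensor] at c1 c2 ⊢
  obtain ⟨nl, nr, nd⟩ := List.nodup_append'.1 n
  rw [List.forall_mem_append] at c1 c2
  have c4 := countP_foldr_glue _ _ nr c1.2 c2.2
  -- The points of `E` are glued before those of `X`. The identity intervals do not meet `E`, so
  -- they can be set aside for that stage and absorbed afterwards.
  rw [List.foldr_append]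
  have hsep : ∀ p ∈ (idStrands (fun i => Sum.inl (X.inLeft SignSeq.empty i))
      (fun i => Sum.inr (Sum.inl (X.inLeft E i))) X.sign (List.finRange X.len) :
        Multiset (Strand S (PlugLabel X Y E))),
      ∀ z ∈ (List.finRange E.len).map (plugPoint X Y E), p.src ≠ some z ∧ p.tgt ≠ some z := by
    intro p hp z hz
    obtain ⟨i, -, rfl⟩ := List.mem_map.1 (Multiset.mem_coe.1 hp)
    obtain ⟨k, -, rfl⟩ := List.mem_map.1 hz
    cases X.sign i <;> simp [plugPoint]
  rw [foldr_glue_add_of_ne _ _ _ hsep] at c4 ⊢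
  refine foldr_glue_idStrands _ _ _ ?_ ?_ _ ?_ _ (List.nodup_finRange _) _ ?_ ?_
  · intro i j h
    simpa using h
  · intro i j
    simp
  · intro i
    exact (plugLabel_inLeft i).symm
  · intro i hi
    have hm := List.mem_map_of_mem (f := fun i => (Sum.inr (Sum.inl (X.inLeft E i)) :
      PlugLabel X Y E)) hi
    rw [(c4 _).1, if_neg (List.disjoint_left.1 nd hm)]
    exact c1.1 _ hm
  · intro i hi
    have hm := List.mem_map_of_mem (f := fun i => (Sum.inr (Sum.inl (X.inLeft E i)) :
      PlugLabel X Y E)) hi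
    rw [(c4 _).2, if_neg (List.disjoint_left.1 nd hm)]
    exact c2.1 _ hm

/-- The components in `R` have no endpoint in `E`, hence pass through unchanged. Only the part `P`
of `M` interacts with `F`. -/
theorem plug_strands (M : Cob S (X.append E) Y) (F : Cob S SignSeq.empty E)
    (P : Multiset (Strand S (BdPt (X.append E) Y))) (R : Multiset (Strand S (BdPt X Y)))
    (hM : M.strands = P + R.map (Strand.relabel (keepLabel X Y E))) :
    (M.plug F).strands = (((List.finRange E.len).map (plugPoint X Y E)).foldr glue
      (plugStack F.strands P)).map (Strand.relabel (plugLabel X Y E)) + R := by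
  have e : plugStack F.strands M.strands = R.map (Strand.relabel fun b =>
      (keepLabel X Y E b).bind (Cob.upperLabel (X.append SignSeq.empty) (X.append E) Y)) +
      plugStack F.strands P := by
    rw [plugStack, hM, Multiset.map_add, Multiset.map_map, plugStack, ← add_assoc, add_comm]
    congr 1
    exact Multiset.map_congr rfl fun p _ => Strand.relabel_relabel _ _ p
  rw [plug_strands_eq, e, foldr_glue_add_of_ne, Multiset.map_add, Multiset.map_map, add_comm]
  · congr 1
    conv_rhs => rw [← Multiset.map_id R]
    refine Multiset.map_congr rfl fun p _ => ?_
    rw [Function.comp_apply, Strand.relabel_relabel]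
    simp only [plugLabel_upper_keep]
    exact p.relabel_some
  · intro p hp z hz
    obtain ⟨q, -, rfl⟩ := Multiset.mem_map.1 hp
    obtain ⟨k, -, rfl⟩ := List.mem_map.1 hz
    rcases q with ⟨s, t, w⟩ | w
    · have h : ∀ s : Option (BdPt X Y), (s.bind fun b => (keepLabel X Y E b).bind
          (Cob.upperLabel (X.append SignSeq.empty) (X.append E) Y)) ≠
            some (plugPoint X Y E k) := by
        rintro (_ | b)
        · simp
        · exact keep_upper_ne_plugPoint b k
      exact ⟨h s, h t⟩
    · simp [Strand.relabel, Strand.src, Strand.tgt]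

/-- Replace one component of a cobordism by components with additional boundary points `E`. -/
theorem exists_cob_of_strands (N : Cob S X Y) (p : Strand S (BdPt X Y))
    (R : Multiset (Strand S (BdPt X Y))) (hN : N.strands = p ::ₘ R)
    (P : Multiset (Strand S (BdPt (X.append E) Y)))
    (h1 : ∀ b b', keepLabel X Y E b = some b' → P.countP (fun q => q.src = some b') =
      if p.src = some b then 1 else 0)
    (h2 : ∀ b b', keepLabel X Y E b = some b' → P.countP (fun q => q.tgt = some b') =
      if p.tgt = some b then 1 else 0)
    (h3 : ∀ k, P.countP (fun q => q.src = some (.inl (X.inRight E k))) =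
      if E.sign k then 1 else 0)
    (h4 : ∀ k, P.countP (fun q => q.tgt = some (.inl (X.inRight E k))) =
      if E.sign k then 0 else 1) :
    ∃ M : Cob S (X.append E) Y, M.strands = P + R.map (Strand.relabel (keepLabel X Y E)) := by
  have hk : ∀ b b', keepLabel X Y E b = some b' → ∀ l, keepLabel X Y E l = some b' ↔ l = b := by
    rintro b b' h l
    rw [← h]
    rcases b with b | b <;> rcases l with l | l <;> simp [keepLabel]
  have hi : ∀ b b', keepLabel X Y E b = some b' →
      isStart (X.append E) Y b' = isStart X Y b := by
    rintro (b | b) b' h <;> obtain rfl := Option.some.inj h <;> simp [isStart]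
  have h0 : ∀ k l, keepLabel X Y E l ≠ some (.inl (X.inRight E k)) := by
    rintro k (l | l) <;> simp [keepLabel]
  have hb : ∀ b', (∃ b, keepLabel X Y E b = some b') ∨ ∃ k, b' = .inl (X.inRight E k) := by
    rintro (i | i)
    · obtain ⟨j, rfl⟩ | ⟨j, rfl⟩ := SignSeq.inLeft_or_inRight X E i
      · exact Or.inl ⟨.inl j, rfl⟩
      · exact Or.inr ⟨j, rfl⟩
    · exact Or.inl ⟨.inr i, rfl⟩
  refine ⟨⟨P + R.map (Strand.relabel (keepLabel X Y E)), fun b' => ?_, fun b' => ?_⟩, rfl⟩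
  · rw [Multiset.countP_add]
    obtain ⟨b, hb⟩ | ⟨k, rfl⟩ := hb b'
    · rw [h1 b b' hb, (countP_relabel _ R b' b (hk b b' hb)).1, hi b b' hb, ← N.starts b, hN,
        countP_src_cons, add_comm]
    · rw [h3, (countP_relabel_eq_zero _ R _ (h0 k)).1]
      simp [isStart]
  · rw [Multiset.countP_add]
    obtain ⟨b, hb⟩ | ⟨k, rfl⟩ := hb b'
    · rw [h2 b b' hb, (countP_relabel _ R b' b (hk b b' hb)).2, hi b b' hb, ← N.ends b, hN,
        countP_tgt_cons, add_comm]
    · rw [h4, (countP_relabel_eq_zero _ R _ (h0 k)).2]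
      simp [isStart]

end Plugging

/-! ### The skein relations on a component of an arbitrary cobordism. -/

section Insertion

variable {K S : Type*} [Field K] {X Y : SignSeq} {a c : FreeMonoid S → K}

theorem glue_pair {L : Type*} [DecidableEq L] (z : L) (p q : Strand S L) (h1 : p.src ≠ some z)
    (h2 : p.tgt = some z) (h3 : q.src = some z) (h4 : q.tgt ≠ some z) :
    glue z (p ::ₘ q ::ₘ 0) = p.join q ::ₘ 0 :=
  glue_eq_join z 0 (fun _ h => absurd h (Multiset.notMem_zero _)) p q h1 h2 h3 h4

theorem countP_src_singleton {L : Type*} [DecidableEq L] (b : L) (p : Strand S L) :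
    ({p} : Multiset (Strand S L)).countP (fun p => p.src = some b) =
      if p.src = some b then 1 else 0 :=
  (countP_src_cons b p 0).trans (by simp)

theorem countP_tgt_singleton {L : Type*} [DecidableEq L] (b : L) (p : Strand S L) :
    ({p} : Multiset (Strand S L)).countP (fun p => p.tgt = some b) =
      if p.tgt = some b then 1 else 0 :=
  (countP_tgt_cons b p 0).trans (by simp)

/-- A skein relation for a family of cobordisms from the empty sequence to `E` implies the
corresponding relation for the cobordisms obtained by plugging the family into a fixed one. -/
theorem isSkeinZero_of_plug {E : SignSeq} (M : Cob S (X.append E) Y)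
    (F : FreeMonoid S → Cob S SignSeq.empty E) (N : FreeMonoid S → Cob S X Y)
    (hN : ∀ w, (N w).strands = (M.plug (F w)).strands) {u : NCPoly K S}
    (hu : IsSkeinZero a c (placePoly F u)) : IsSkeinZero a c (placePoly N u) := by
  have := isSkeinZero_plug M hu
  rw [lmapDomain_placePoly] at this
  rwa [show N = fun w => M.plug (F w) from funext fun w => Cob.ext (hN w)]

/-- Cut the component after its dots. The piece with the floating endpoint and the word is
`Cob.fromFloating w`; the rest is an interval without dots in a fixed cobordism `M` with one
additional bottom point `+`. -/
theorem isSkeinZero_insert_none_some (N : FreeMonoid S → Cob S X Y) (t : BdPt X Y)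
    (R : Multiset (Strand S (BdPt X Y))) (hN : ∀ w, (N w).strands = .arc none (some t) w ::ₘ R)
    (u : NCPoly K S) (hu : u ∈ leftSyntactic a) : IsSkeinZero a c (placePoly N u) := by
  let E := SignSeq.one true
  let k : Fin E.len := (0 : Fin 1)
  have hk : ∀ l : Fin E.len, l = k := Subsingleton.elim (α := Fin 1) (b := k)
  have hsg : E.sign k = true := rfl
  have hP : ∃ M : Cob S (X.append E) Y, M.strands =
      {.arc (some (.inl (X.inRight E k))) (keepLabel X Y E t) 1} +
        R.map (Strand.relabel (keepLabel X Y E)) := by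
    refine exists_cob_of_strands (N 1) _ R (hN 1) _ ?_ ?_ (fun l => ?_) (fun l => ?_)
    · rintro (b | b) b' h <;> obtain rfl := Option.some.inj h <;> simp [countP_src_singleton]
    · rintro (b | b) b' h <;> obtain rfl := Option.some.inj h <;> rcases t with t | t <;>
        simp [keepLabel, countP_tgt_singleton]
    · simp [hk l, countP_src_singleton, hsg]
    · rcases t with t | t <;> simp [hk l, keepLabel, countP_tgt_singleton, hsg]
  obtain ⟨M, hM⟩ := hP
  refine isSkeinZero_of_plug M Cob.fromFloating N (fun w => ?_) (.fromFloating u hu)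
  have e : plugStack (Cob.fromFloating w).strands
      {.arc (some (.inl (X.inRight E k))) (keepLabel X Y E t) 1} =
      .arc none (some (plugPoint X Y E k)) w ::ₘ
      .arc (some (plugPoint X Y E k)) ((keepLabel X Y E t).bind
        (Cob.upperLabel (X.append SignSeq.empty) (X.append E) Y)) 1 ::ₘ 0 := rfl
  have e' : (List.finRange E.len).map (plugPoint X Y E) = [plugPoint X Y E k] := rfl
  rw [plug_strands M _ _ R hM, hN, e, e', List.foldr_cons, List.foldr_nil,
    glue_pair _ _ _ (by simp) rfl rfl (by exact keep_upper_ne_plugPoint t k),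
    Multiset.map_cons, Strand.join, Strand.relabel, Strand.tgt_arc, plugLabel_upper_keep]
  simp [Strand.word]

/-- Here the cut comes before the dots, the additional point is `-`, and the piece with the word is
`Cob.toFloating w`. -/
theorem isSkeinZero_insert_some_none (N : FreeMonoid S → Cob S X Y) (s : BdPt X Y)
    (R : Multiset (Strand S (BdPt X Y))) (hN : ∀ w, (N w).strands = .arc (some s) none w ::ₘ R)
    (u : NCPoly K S) (hu : u ∈ rightSyntactic a) : IsSkeinZero a c (placePoly N u) := by
  let E := SignSeq.one false
  let k : Fin E.len := (0 : Fin 1)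
  have hk : ∀ l : Fin E.len, l = k := Subsingleton.elim (α := Fin 1) (b := k)
  have hsg : E.sign k = false := rfl
  have hP : ∃ M : Cob S (X.append E) Y, M.strands =
      {.arc (keepLabel X Y E s) (some (.inl (X.inRight E k))) 1} +
        R.map (Strand.relabel (keepLabel X Y E)) := by
    refine exists_cob_of_strands (N 1) _ R (hN 1) _ ?_ ?_ (fun l => ?_) (fun l => ?_)
    · rintro (b | b) b' h <;> obtain rfl := Option.some.inj h <;> rcases s with s | s <;>
        simp [keepLabel, countP_src_singleton]
    · rintro (b | b) b' h <;> obtain rfl := Option.some.inj h <;> simp [countP_tgt_singleton]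
    · rcases s with s | s <;> simp [hk l, keepLabel, countP_src_singleton, hsg]
    · simp [hk l, countP_tgt_singleton, hsg]
  obtain ⟨M, hM⟩ := hP
  refine isSkeinZero_of_plug M Cob.toFloating N (fun w => ?_) (.toFloating u hu)
  have e : plugStack (Cob.toFloating w).strands
      {.arc (keepLabel X Y E s) (some (.inl (X.inRight E k))) 1} =
      .arc (some (plugPoint X Y E k)) none w ::ₘ
      .arc ((keepLabel X Y E s).bind (Cob.upperLabel (X.append SignSeq.empty) (X.append E) Y))
        (some (plugPoint X Y E k)) 1 ::ₘ 0 := rfl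
  have e' : (List.finRange E.len).map (plugPoint X Y E) = [plugPoint X Y E k] := rfl
  rw [plug_strands M _ _ R hM, hN, e, e', List.foldr_cons, List.foldr_nil, Multiset.cons_swap,
    glue_pair _ _ _ (by exact keep_upper_ne_plugPoint s k) rfl rfl (by simp),
    Multiset.map_cons, Strand.join, Strand.relabel, Strand.src_arc, plugLabel_upper_keep]
  simp [Strand.word]

/-- The interval from a top point `(-)` to a top point `(+)`. -/
def Cob.coev (S : Type*) :
    Cob S SignSeq.empty ((SignSeq.one false).append (SignSeq.one true)) where
  strands := {.arc (some (.inr (0 : Fin 2))) (some (.inr (1 : Fin 2))) 1}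
  starts := by rintro (i | i); exacts [i.elim0, by fin_cases i <;> rfl]
  ends := by rintro (i | i); exacts [i.elim0, by fin_cases i <;> rfl]

/-- The interval with the word `w` from a top point `(-)` to a top point `(+)`. -/
def Cob.cup (w : FreeMonoid S) :
    Cob S SignSeq.empty ((SignSeq.one false).append (SignSeq.one true)) :=
  (Cob.coev S).comp ((Cob.id S (SignSeq.one false)).tensor (Cob.through w))

theorem Cob.cup_strands (w : FreeMonoid S) :
    (Cob.cup w).strands = {.arc (some (.inr (0 : Fin 2))) (some (.inr (1 : Fin 2))) w} := by
  let m (j : Fin 2) : Fin 0 ⊕ Fin 2 ⊕ Fin 2 := .inr (.inl j)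
  let o (j : Fin 2) : Fin 0 ⊕ Fin 2 ⊕ Fin 2 := .inr (.inr j)
  have e : (Cob.cup w).strands = ([m 0, m 1].foldr glue
      ((.arc (some (m 0)) (some (m 1)) 1 : Strand S (Fin 0 ⊕ Fin 2 ⊕ Fin 2)) ::ₘ
        .arc (some (o 0)) (some (m 0)) 1 ::ₘ .arc (some (m 1)) (some (o 1)) w ::ₘ 0)).map
      (Strand.relabel (Cob.outerLabel SignSeq.empty
        ((SignSeq.one false).append (SignSeq.one true))
        ((SignSeq.one false).append (SignSeq.one true)))) := rfl
  rw [e, List.foldr_cons, List.foldr_cons, List.foldr_nil, Multiset.cons_swap,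
    glue_cons_of_ne _ _ _ (by simp [m, o]) (by simp [m]),
    glue_pair _ _ _ (by simp [m]) rfl rfl (by simp [m, o]),
    glue_pair _ _ _ (by simp [m, o]) rfl rfl (by simp [m, o])]
  simp only [Strand.join, Strand.word, mul_one]
  rfl

/-- Plugging accepts only cobordisms out of the empty sequence, so the relation on the interval from
`(+)` to `(+)` is bent into one on a cup. -/
theorem isSkeinZero_cup (u : NCPoly K S) (hu : u ∈ pairSyntactic a c) :
    IsSkeinZero a c (placePoly Cob.cup u) := by
  have := IsSkeinZero.comp_below (Cob.coev S) _ (IsSkeinZero.tensor_left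
    (Cob.id S (SignSeq.one false)) _ (IsSkeinZero.through (a := a) (c := c) u hu))
  rwa [lmapDomain_placePoly, lmapDomain_placePoly] at this

theorem isSkeinZero_insert_some_some (N : FreeMonoid S → Cob S X Y) (s t : BdPt X Y)
    (R : Multiset (Strand S (BdPt X Y)))
    (hN : ∀ w, (N w).strands = .arc (some s) (some t) w ::ₘ R)
    (u : NCPoly K S) (hu : u ∈ pairSyntactic a c) : IsSkeinZero a c (placePoly N u) := by
  let E := (SignSeq.one false).append (SignSeq.one true)
  let k (j : Fin 2) : Fin E.len := j
  have hk : ∀ l : Fin E.len, l = k 0 ∨ l = k 1 := by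
    intro l
    have := Fin.exists_fin_two.1 ⟨(l : Fin 2), rfl⟩
    exact this
  have hne : k 0 ≠ k 1 := Fin.zero_ne_one (n := 0)
  have hsg : E.sign (k 0) = false := rfl
  have hsg' : E.sign (k 1) = true := rfl
  -- Cut on both sides of the dots: the middle piece becomes the cup, and the two outer pieces run
  -- from `s` to the first additional point and from the second additional point to `t`.
  have hP : ∃ M : Cob S (X.append E) Y, M.strands =
      .arc (keepLabel X Y E s) (some (.inl (X.inRight E (k 0)))) 1 ::ₘ
      .arc (some (.inl (X.inRight E (k 1)))) (keepLabel X Y E t) 1 ::ₘ 0 +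
        R.map (Strand.relabel (keepLabel X Y E)) := by
    refine exists_cob_of_strands (N 1) _ R (hN 1) _ ?_ ?_ (fun l => ?_) (fun l => ?_)
    · rintro (b | b) b' h <;> obtain rfl := Option.some.inj h <;> rcases s with s | s <;>
        simp [keepLabel, countP_src_cons, countP_src_singleton]
    · rintro (b | b) b' h <;> obtain rfl := Option.some.inj h <;> rcases t with t | t <;>
        simp [keepLabel, countP_tgt_singleton]
    · obtain rfl | rfl := hk l <;> rcases s with s | s <;>
        simp [keepLabel, countP_src_singleton, hsg, hsg', hne.symm]
    · obtain rfl | rfl := hk l <;> rcases t with t | t <;>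
        simp [keepLabel, countP_tgt_cons, countP_tgt_singleton, hsg, hsg', hne]
  obtain ⟨M, hM⟩ := hP
  refine isSkeinZero_of_plug M Cob.cup N (fun w => ?_) (isSkeinZero_cup u hu)
  have e : plugStack (Cob.cup w).strands
      (.arc (keepLabel X Y E s) (some (.inl (X.inRight E (k 0)))) 1 ::ₘ
      .arc (some (.inl (X.inRight E (k 1)))) (keepLabel X Y E t) 1 ::ₘ 0) =
      .arc (some (plugPoint X Y E (k 0))) (some (plugPoint X Y E (k 1))) w ::ₘ
      .arc ((keepLabel X Y E s).bind (Cob.upperLabel (X.append SignSeq.empty) (X.append E) Y))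
        (some (plugPoint X Y E (k 0))) 1 ::ₘ
      .arc (some (plugPoint X Y E (k 1))) ((keepLabel X Y E t).bind
        (Cob.upperLabel (X.append SignSeq.empty) (X.append E) Y)) 1 ::ₘ 0 := by
    rw [Cob.cup_strands]
    rfl
  have e' : (List.finRange E.len).map (plugPoint X Y E) =
      [plugPoint X Y E (k 0), plugPoint X Y E (k 1)] := rfl
  have hne' : plugPoint X Y E (k 0) ≠ plugPoint X Y E (k 1) := by simp [plugPoint, hne]
  rw [plug_strands M _ _ R hM, hN, e, e', List.foldr_cons, List.foldr_cons, List.foldr_nil,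
    Multiset.cons_swap,
    glue_cons_of_ne _ _ _ (by exact keep_upper_ne_plugPoint s (k 1)) (by simpa using hne'),
    glue_pair _ _ _ (by simpa using hne') rfl rfl (by exact keep_upper_ne_plugPoint t (k 1)),
    glue_pair _ _ _ (by exact keep_upper_ne_plugPoint s (k 0)) rfl rfl
      (by exact keep_upper_ne_plugPoint t (k 0)),
    Multiset.map_cons, Strand.join, Strand.relabel, Strand.src_arc, Strand.join_tgt,
    Strand.tgt_arc, plugLabel_upper_keep, plugLabel_upper_keep]
  simp [Strand.word, Strand.join]

/-- An element of the ideal of a component that is not floating vanishes on it. -/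
theorem isSkeinZero_insert (N : FreeMonoid S → Cob S X Y) (s t : Option (BdPt X Y))
    (R : Multiset (Strand S (BdPt X Y))) (hN : ∀ w, (N w).strands = .arc s t w ::ₘ R)
    (hst : (s, t) ≠ (none, none)) (u : NCPoly K S) (hu : u ∈ arcIdeal a c s t) :
    IsSkeinZero a c (placePoly N u) := by
  rcases s with _ | s <;> rcases t with _ | t
  · exact absurd rfl hst
  · exact isSkeinZero_insert_none_some N t R hN u hu
  · exact isSkeinZero_insert_some_none N s R hN u hu
  · exact isSkeinZero_insert_some_some N s t R hN u hu

/-- A floating component can be removed at the cost of a scalar. -/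
theorem isSkeinZero_remove (N N' : Cob S X Y) (F : Cob S SignSeq.empty SignSeq.empty) (r : K)
    (hF : IsSkeinZero a c (Finsupp.single F 1 - r • Finsupp.single (Cob.nil S) 1))
    (p : Strand S (BdPt X Y))
    (hp : F.strands.map (Strand.relabel fun _ => none) = {p})
    (hN : N.strands = p ::ₘ N'.strands) :
    IsSkeinZero a c (Finsupp.single N 1 - r • Finsupp.single N' 1) := by
  have h0 : p.src = none ∧ p.tgt = none := by
    obtain ⟨q, -, rfl⟩ := Multiset.mem_map.1 (hp ▸ Multiset.mem_singleton_self p)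
    rcases q with ⟨s, t, w⟩ | w <;> simp [Strand.relabel, Strand.src, Strand.tgt]
  -- With `E` empty nothing is cut: `M` is `N'` with a formally extended source, and plugging is
  -- disjoint union.
  have hP : ∃ M : Cob S (X.append SignSeq.empty) Y, M.strands =
      0 + N'.strands.map (Strand.relabel (keepLabel X Y SignSeq.empty)) :=
    exists_cob_of_strands N p _ hN _ (by simp [h0]) (by simp [h0]) (fun l => l.elim0)
      fun l => l.elim0
  obtain ⟨M, hM⟩ := hP
  have e' : (List.finRange SignSeq.empty.len).map (plugPoint X Y SignSeq.empty) = [] := rfl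
  have h1 : M.plug F = N := Cob.ext <| by
    rw [plug_strands M F _ _ hM, e', List.foldr_nil, plugStack, Multiset.map_zero, add_zero,
      Multiset.map_map, hN, ← Multiset.singleton_add, ← hp]
    refine congrArg (· + N'.strands) (Multiset.map_congr rfl fun q _ => ?_)
    rw [Function.comp_apply, Strand.relabel_relabel]
    exact Strand.relabel_congr _ (by rintro (x | x) <;> exact x.elim0)
      (by rintro (x | x) <;> exact x.elim0)
  have h2 : M.plug (Cob.nil S) = N' := Cob.ext <| by
    rw [plug_strands M _ _ _ hM, e']
    exact zero_add _
  have := isSkeinZero_plug M hF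
  rwa [map_sub, map_smul, Finsupp.lmapDomain_apply, Finsupp.lmapDomain_apply,
    Finsupp.mapDomain_single, Finsupp.mapDomain_single, h1, h2] at this

end Insertion

/-! ### Multilinearity in the polynomials on the components. -/

section Multilinear

/-- The values of a multilinear map on products of spans are controlled by the values on the
products of the spanning sets. -/
theorem MultilinearMap.map_mem_of_forall_mem_span {ι K V M : Type*} [Finite ι] [Field K]
    [AddCommGroup V] [Module K V] [AddCommGroup M] [Module K M]
    (f : MultilinearMap K (fun _ : ι => V) M) (W : Submodule K M) (s : ι → Set V)
    (h : ∀ d, (∀ i, d i ∈ s i) → f d ∈ W) (d : ι → V)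
    (hd : ∀ i, d i ∈ Submodule.span K (s i)) : f d ∈ W := by
  classical
  have := Fintype.ofFinite ι
  -- `T` collects the slots for which only membership in the span is known. Enlarging `T` by one
  -- slot uses linearity in that slot alone.
  have key : ∀ (T : Finset ι) (d : ι → V), (∀ i ∈ T, d i ∈ Submodule.span K (s i)) →
      (∀ i ∉ T, d i ∈ s i) → f d ∈ W := by
    intro T
    induction T using Finset.induction_on with
    | empty => exact fun d _ hd => h d fun i => hd i (Finset.notMem_empty i)
    | insert i T hi ih =>
      intro d h1 h2
      have hle : Submodule.span K (s i) ≤ W.comap (f.toLinearMap d i) := by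
        refine Submodule.span_le.2 fun v hv => ih _ (fun j hj => ?_) fun j hj => ?_
        · rw [Function.update_of_ne (ne_of_mem_of_not_mem hj hi)]
          exact h1 j (Finset.mem_insert_of_mem hj)
        · by_cases hji : j = i
          · subst hji
            rwa [Function.update_self]
          · rw [Function.update_of_ne hji]
            exact h2 j (by simp [hji, hj])
      have := hle (h1 i (Finset.mem_insert_self i T))
      rwa [Submodule.mem_comap, MultilinearMap.toLinearMap_apply, Function.update_eq_self] at this
  exact key Finset.univ d (fun i _ => hd i) fun i hi => absurd (Finset.mem_univ i) hi

variable {K S : Type*} [Field K] {X Y : SignSeq}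

theorem ViewableCob.decoratePoly_eq_sum (x : ViewableCob X Y) (d : x.arcs → NCPoly K S)
    (T : x.arcs → Finset (FreeMonoid S)) (hT : ∀ p, (d p).coeff.support ⊆ T p) :
    x.decoratePoly d = ∑ w ∈ Fintype.piFinset T,
      Finsupp.single (x.decorate w) (∏ p, (d p).coeff (w p)) := by
  refine Finset.sum_subset (Fintype.piFinset_subset _ _ hT) fun w _ hw => ?_
  obtain ⟨p, hp⟩ := not_forall.1 (mt Fintype.mem_piFinset.2 hw)
  have h0 : ∏ p, (d p).coeff (w p) = 0 :=
    Finset.prod_eq_zero (Finset.mem_univ p) (Finsupp.notMem_support_iff.1 hp)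
  rw [h0, Finsupp.single_zero]

/-- With an index set `T` that does not depend on `u`, the right-hand side is visibly linear in `u`.
This yields additivity and homogeneity in each slot. -/
theorem ViewableCob.decoratePoly_update (x : ViewableCob X Y) (d : x.arcs → NCPoly K S)
    (p : x.arcs) (u : NCPoly K S) (T : x.arcs → Finset (FreeMonoid S))
    (hT : ∀ p, (d p).coeff.support ⊆ T p) (hu : u.coeff.support ⊆ T p) :
    x.decoratePoly (Function.update d p u) = ∑ w ∈ Fintype.piFinset T,
      Finsupp.single (x.decorate w)
        (u.coeff (w p) * ∏ q ∈ Finset.univ.erase p, (d q).coeff (w q)) := by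
  rw [x.decoratePoly_eq_sum _ T fun q => ?_]
  · refine Finset.sum_congr rfl fun w _ => ?_
    rw [← Finset.mul_prod_erase _ _ (Finset.mem_univ p), Function.update_self]
    congr 2
    refine Finset.prod_congr rfl fun q hq => ?_
    rw [Function.update_of_ne (Finset.ne_of_mem_erase hq)]
  · by_cases hq : q = p
    · subst hq
      rwa [Function.update_self]
    · rw [Function.update_of_ne hq]
      exact hT q

/-- Writing polynomials on the components of a viewable cobordism, as a multilinear map. -/
noncomputable def ViewableCob.decorateMultilinear (x : ViewableCob X Y) :
    MultilinearMap K (fun _ : x.arcs => NCPoly K S) (LinCob K S X Y) :=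
  MultilinearMap.mk' x.decoratePoly
    (fun d p u v => by
      classical
      let T : x.arcs → Finset (FreeMonoid S) := fun q =>
        (d q).coeff.support ∪ (u.coeff.support ∪ v.coeff.support)
      have hT : ∀ q, (d q).coeff.support ⊆ T q := fun q => Finset.subset_union_left
      have hu : u.coeff.support ⊆ T p :=
        Finset.subset_union_left.trans Finset.subset_union_right
      have hv : v.coeff.support ⊆ T p :=
        Finset.subset_union_right.trans Finset.subset_union_right
      have huv : (u + v).coeff.support ⊆ T p :=
        Finsupp.support_add.trans Finset.subset_union_right
      rw [x.decoratePoly_update d p _ T hT hu, x.decoratePoly_update d p _ T hT hv,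
        x.decoratePoly_update d p _ T hT huv, ← Finset.sum_add_distrib]
      refine Finset.sum_congr rfl fun w _ => ?_
      rw [MonoidAlgebra.coeff_add, Finsupp.add_apply, add_mul, Finsupp.single_add])
    (fun d p r u => by
      classical
      let T : x.arcs → Finset (FreeMonoid S) := fun q => (d q).coeff.support ∪ u.coeff.support
      have hT : ∀ q, (d q).coeff.support ⊆ T q := fun q => Finset.subset_union_left
      have hu : u.coeff.support ⊆ T p := Finset.subset_union_right
      have hru : (r • u).coeff.support ⊆ T p := Finsupp.support_smul.trans hu
      rw [x.decoratePoly_update d p _ T hT hu, x.decoratePoly_update d p _ T hT hru,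
        Finset.smul_sum]
      refine Finset.sum_congr rfl fun w _ => ?_
      rw [MonoidAlgebra.coeff_smul, Finsupp.smul_apply, smul_eq_mul, mul_assoc,
        Finsupp.smul_single, smul_eq_mul])

theorem ViewableCob.decoratePoly_single (x : ViewableCob X Y) (w : x.arcs → FreeMonoid S) :
    x.decoratePoly (fun p => (MonoidAlgebra.single (w p) 1 : NCPoly K S)) =
      Finsupp.single (x.decorate w) 1 := by
  have hT : ∀ p, (MonoidAlgebra.single (w p) 1 : NCPoly K S).coeff.support ⊆ {w p} :=
    fun p => Finsupp.support_single_subset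
  rw [x.decoratePoly_eq_sum _ (fun p => {w p}) hT,
    Fintype.piFinset_singleton, Finset.sum_singleton]
  simp

theorem ViewableCob.decoratePoly_update_single (x : ViewableCob X Y) (w : x.arcs → FreeMonoid S)
    (p : x.arcs) (u : NCPoly K S) :
    x.decoratePoly (Function.update (fun q => (MonoidAlgebra.single (w q) 1 : NCPoly K S)) p u) =
      placePoly (fun v => x.decorate (Function.update w p v)) u := by
  have key : (x.decorateMultilinear (K := K) (S := S)).toLinearMap
      (fun q => MonoidAlgebra.single (w q) 1) p =
      placePoly (fun v => x.decorate (Function.update w p v)) := by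
    refine MonoidAlgebra.lhom_ext' fun v => LinearMap.ext_ring ?_
    refine Eq.trans ?_ (placePoly_single _ v 1).symm
    refine Eq.trans ?_ (x.decoratePoly_single _)
    refine congrArg x.decoratePoly (funext fun q => ?_)
    by_cases hq : q = p
    · subst hq
      simp
    · simp [hq]
  exact LinearMap.congr_fun key u

theorem ViewableCob.decorate_update_strands (x : ViewableCob X Y) (w : x.arcs → FreeMonoid S)
    (p : x.arcs) (v : FreeMonoid S) :
    (x.decorate (Function.update w p v)).strands = .arc p.1.1 p.1.2 v ::ₘ
      (Finset.univ.erase p).val.map fun q => .arc q.1.1 q.1.2 (w q) := by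
  have e : (Finset.univ : Finset x.arcs).val = p ::ₘ (Finset.univ.erase p).val := by
    rw [← Finset.insert_val_of_notMem (Finset.notMem_erase p _),
      Finset.insert_erase (Finset.mem_univ p)]
  change Finset.univ.val.map (fun q : x.arcs =>
    Strand.arc q.1.1 q.1.2 (Function.update w p v q)) = _
  rw [e, Multiset.map_cons, Function.update_self]
  refine congrArg _ (Multiset.map_congr rfl fun q hq => ?_)
  rw [Function.update_of_ne (Finset.ne_of_mem_erase hq)]

/-- A viewable cobordism vanishes if one of its components carries an element of the ideal. -/
theorem ViewableCob.decoratePoly_mem_skeinIdeal (a c : FreeMonoid S → K) (x : ViewableCob X Y)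
    (d : x.arcs → NCPoly K S) (p : x.arcs) (hp : d p ∈ arcIdeal a c p.1.1 p.1.2) :
    x.decoratePoly d ∈ skeinIdeal a c X Y := by
  -- By multilinearity the components other than `p` may be assumed to carry words. Then the
  -- decoration is a family with one inserted polynomial, to which `isSkeinZero_insert` applies.
  refine x.decorateMultilinear.map_mem_of_forall_mem_span (skeinIdeal a c X Y)
    (fun q => if q = p then (arcIdeal a c p.1.1 p.1.2 : Set (NCPoly K S)) else
      Set.range fun w => MonoidAlgebra.single w 1) (fun d hd => ?_) d fun q => ?_
  · have hw : ∀ q, ∃ w : FreeMonoid S, q ≠ p → MonoidAlgebra.single w 1 = d q := by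
      intro q
      by_cases hq : q = p
      · exact ⟨1, fun h => absurd hq h⟩
      · have := hd q
        rw [if_neg hq] at this
        obtain ⟨w, hw⟩ := this
        exact ⟨w, fun _ => hw⟩
    choose w hw using hw
    have e : d = Function.update (fun q => (MonoidAlgebra.single (w q) 1 : NCPoly K S)) p
        (d p) := by
      funext q
      by_cases hq : q = p
      · subst hq
        rw [Function.update_self]
      · rw [Function.update_of_ne hq, hw q hq]
    have hdp := hd p
    rw [if_pos rfl] at hdp
    change IsSkeinZero a c (x.decoratePoly d)
    rw [e, decoratePoly_update_single]
    exact isSkeinZero_insert _ p.1.1 p.1.2 _ (fun v => x.decorate_update_strands w p v)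
      (fun h => x.viewable (h ▸ p.2)) _ hdp
  · by_cases hq : q = p
    · subst hq
      rw [if_pos rfl]
      exact Submodule.subset_span hp
    · rw [if_neg hq]
      have := (MonoidAlgebra.basis (FreeMonoid S) K).span_eq
      have e : (⇑(MonoidAlgebra.basis (FreeMonoid S) K) : FreeMonoid S → NCPoly K S) =
        fun w => MonoidAlgebra.single w 1 := rfl
      rw [e] at this
      rw [this]
      trivial

end Multilinear

/-! ### Cobordisms without floating components. -/

section Decomposition

variable {S : Type*} {X Y : SignSeq}

/-- A cobordism without floating components is a decorated viewable cobordism. -/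
theorem Cob.exists_eq_decorate (N : Cob S X Y)
    (hN : ∀ p ∈ N.strands, (p.src, p.tgt) ≠ (none, none)) :
    ∃ (x : ViewableCob X Y) (w : x.arcs → FreeMonoid S), N = x.decorate w := by
  classical
  let ends : Strand S (BdPt X Y) → Option (BdPt X Y) × Option (BdPt X Y) :=
    fun p => (p.src, p.tgt)
  have h1 : ∀ b, (N.strands.map ends).countP (fun q => q.1 = some b) =
      if isStart X Y b then 1 else 0 := fun b => by
    rw [Multiset.countP_map, ← Multiset.countP_eq_card_filter, N.starts b]
  have h2 : ∀ b, (N.strands.map ends).countP (fun q => q.2 = some b) =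
      if isStart X Y b then 0 else 1 := fun b => by
    rw [Multiset.countP_map, ← Multiset.countP_eq_card_filter, N.ends b]
  have hnone : (none, none) ∉ N.strands.map ends := fun h => by
    obtain ⟨p, hp, e⟩ := Multiset.mem_map.1 h
    exact hN p hp e
  -- A repeated pair of endpoints would put two components at the same boundary point, because at
  -- least one entry of the pair is not floating.
  have hnd : (N.strands.map ends).Nodup := by
    refine Multiset.nodup_iff_le.2 fun q hq => ?_
    have hc : ∀ (P : Option (BdPt X Y) × Option (BdPt X Y) → Prop) [DecidablePred P], P q →
        2 ≤ (N.strands.map ends).countP P := fun P _ h => by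
      refine le_trans (le_of_eq ?_) (Multiset.countP_le_of_le P hq)
      rw [Multiset.countP_cons_of_pos _ h, Multiset.countP_cons_of_pos _ h, Multiset.countP_zero]
    obtain ⟨_ | s, t⟩ := q
    · obtain _ | t := t
      · exact hnone (Multiset.mem_of_le hq (Multiset.mem_cons_self _ _))
      · have := (hc (fun q => q.2 = some t) rfl).trans_eq (h2 t)
        split_ifs at this <;> omega
    · have := (hc (fun q => q.1 = some s) rfl).trans_eq (h1 s)
      split_ifs at this <;> omega
  let x : ViewableCob X Y :=
    { arcs := ⟨N.strands.map ends, hnd⟩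
      viewable := hnone
      starts := fun b => by
        rw [Finset.card_def, Finset.filter_val, ← Multiset.countP_eq_card_filter, h1]
      ends := fun b => by
        rw [Finset.card_def, Finset.filter_val, ← Multiset.countP_eq_card_filter, h2] }
  have hσ : ∀ q : x.arcs, ∃ p ∈ N.strands, ends p = q.1 := fun q => Multiset.mem_map.1 q.2
  choose σ hσ hσ' using hσ
  refine ⟨x, fun q => (σ q).word, Cob.ext ?_⟩
  have e : (x.decorate fun q => (σ q).word).strands = Finset.univ.val.map σ := by
    refine Multiset.map_congr rfl fun q _ => ?_
    obtain ⟨g1, g2⟩ := Prod.ext_iff.1 (hσ' q)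
    rw [← g1, ← g2]
    rcases h : σ q with ⟨s, t, w⟩ | w
    · simp [ends, h, Strand.word]
    · exact absurd (by rw [h]; rfl) (hN _ (hσ q))
  have hinj : Function.Injective σ := fun q q' h =>
    Subtype.ext ((hσ' q).symm.trans ((congrArg ends h).trans (hσ' q')))
  rw [e, Multiset.Nodup.ext (Multiset.Nodup.of_map _ hnd) (Finset.univ.nodup.map hinj)]
  intro p
  rw [Multiset.mem_map]
  constructor
  · intro hp
    have hq : ends p ∈ x.arcs := Multiset.mem_map_of_mem ends hp
    exact ⟨⟨ends p, hq⟩, Finset.mem_univ _,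
      Multiset.inj_on_of_nodup_map hnd _ (hσ _) _ hp (hσ' _)⟩
  · rintro ⟨q, -, rfl⟩
    exact hσ q

theorem Cob.exists_of_strands_eq_cons (N : Cob S X Y) (p : Strand S (BdPt X Y))
    (R : Multiset (Strand S (BdPt X Y))) (hN : N.strands = p ::ₘ R) (h1 : p.src = none)
    (h2 : p.tgt = none) : ∃ N' : Cob S X Y, N'.strands = R := by
  refine ⟨⟨R, fun b => ?_, fun b => ?_⟩, rfl⟩
  · rw [← N.starts b, hN, countP_src_cons, h1]
    simp
  · rw [← N.ends b, hN, countP_tgt_cons, h2]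
    simp

end Decomposition

/-! ### The basic cobordisms span, and there are finitely many of them. -/

section Spanning

variable {K S : Type*} [Field K] {X Y : SignSeq} {a c : FreeMonoid S → K}

theorem exists_smul_of_floating (N : Cob S X Y) (p : Strand S (BdPt X Y))
    (R : Multiset (Strand S (BdPt X Y))) (hN : N.strands = p ::ₘ R) (h1 : p.src = none)
    (h2 : p.tgt = none) : ∃ (N' : Cob S X Y) (r : K), N'.strands = R ∧
      Finsupp.single N 1 - r • Finsupp.single N' 1 ∈ skeinIdeal a c X Y := by
  obtain ⟨N', rfl⟩ := N.exists_of_strands_eq_cons p R hN h1 h2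
  rcases p with ⟨s, t, w⟩ | w
  · rw [Strand.src_arc] at h1
    rw [Strand.tgt_arc] at h2
    subst h1 h2
    exact ⟨N', a w, rfl, isSkeinZero_remove N N' _ _ (.floatingInterval w) _ rfl hN⟩
  · induction w using Quotient.inductionOn with
    | _ l =>
      exact ⟨N', c (FreeMonoid.ofList l), rfl, isSkeinZero_remove N N' _ _
        (.floatingCircle (FreeMonoid.ofList l)) _ rfl hN⟩

theorem span_toSkeinHom (B Bl Br : Set (NCPoly K S))
    (hB : DescendsToBasis (pairSyntactic a c) B) (hBl : DescendsToBasis (leftSyntactic a) Bl)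
    (hBr : DescendsToBasis (rightSyntactic a) Br) :
    Submodule.span K
      (Set.range fun x : BasicCob B Bl Br X Y => (x.toSkeinHom a c : SkeinHom a c X Y)) = ⊤ := by
  set W := Submodule.span K
    (Set.range fun x : BasicCob B Bl Br X Y => (x.toSkeinHom a c : SkeinHom a c X Y))
  let Q := (skeinIdeal a c X Y).mkQ
  have hpoly : ∀ (x : ViewableCob X Y) (d : x.arcs → NCPoly K S),
      x.decoratePoly d ∈ W.comap Q := by
    intro x d
    refine x.decorateMultilinear.map_mem_of_forall_mem_span (W.comap Q)
      (fun p => allowed B Bl Br p.1 ∪ (arcIdeal a c p.1.1 p.1.2 : Set (NCPoly K S)))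
      (fun d hd => ?_) d fun p => ?_
    -- Either all polynomials are allowed, which gives a member of the family, or one of them lies
    -- in the ideal of its component, which gives zero.
    · by_cases h : ∀ p, d p ∈ allowed B Bl Br p.1
      · exact Submodule.subset_span ⟨⟨x, fun p => ⟨d p, h p⟩⟩, rfl⟩
      · obtain ⟨p, hp⟩ := not_forall.1 h
        have h0 : Q (x.decoratePoly d) = 0 := (Submodule.Quotient.mk_eq_zero _).2
          (x.decoratePoly_mem_skeinIdeal a c d p ((hd p).resolve_left hp))
        change Q (x.decoratePoly d) ∈ W
        rw [h0]
        exact zero_mem W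
    · rw [(allowed_descendsToBasis hB hBl hBr p.1 fun h => x.viewable (h ▸ p.2)).span_union]
      trivial
  -- Induction on the number of components: a floating component is exchanged for a scalar, and a
  -- cobordism without any is a decorated viewable one.
  have hsingle : ∀ (n : ℕ) (N : Cob S X Y), N.strands.card = n →
      Finsupp.single N 1 ∈ W.comap Q := by
    intro n
    induction n with
    | zero =>
      intro N hn
      obtain ⟨x, w, rfl⟩ := N.exists_eq_decorate (by simp [Multiset.card_eq_zero.1 hn])
      rw [← x.decoratePoly_single]
      exact hpoly x _
    | succ n ih =>
      intro N hn
      by_cases h : ∀ p ∈ N.strands, (p.src, p.tgt) ≠ (none, none)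
      · obtain ⟨x, w, rfl⟩ := N.exists_eq_decorate h
        rw [← x.decoratePoly_single]
        exact hpoly x _
      · push Not at h
        obtain ⟨p, hp, h⟩ := h
        obtain ⟨R, hR⟩ := Multiset.exists_cons_of_mem hp
        obtain ⟨h1, h2⟩ := Prod.ext_iff.1 h
        obtain ⟨N', r, hN', hr⟩ := exists_smul_of_floating (a := a) (c := c) N p R hR h1 h2
        have hc : N'.strands.card = n := by
          rw [hR, Multiset.card_cons] at hn
          rw [hN']
          exact Nat.succ_injective hn
        have hQ : Q (Finsupp.single N 1) = Q (r • Finsupp.single N' 1) :=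
          (Submodule.Quotient.eq _).2 hr
        rw [Submodule.mem_comap, hQ, map_smul]
        exact W.smul_mem r (ih N' hc)
  have htop : W.comap Q = ⊤ := by
    refine eq_top_iff.2 fun y _ => ?_
    induction y using Finsupp.induction_linear with
    | zero => exact zero_mem _
    | add y z hy hz => exact add_mem (hy trivial) (hz trivial)
    | single N r =>
      rw [← mul_one r, ← smul_eq_mul, ← Finsupp.smul_single]
      exact Submodule.smul_mem _ r (hsingle _ N rfl)
  refine eq_top_iff.2 fun y _ => ?_
  obtain ⟨z, rfl⟩ := Submodule.mkQ_surjective _ y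
  exact (htop ▸ Submodule.mem_top : z ∈ W.comap Q)

/-- A viewable cobordism is a set of pairs from a finite set. On each component the allowed
polynomials represent a basis of a finite-dimensional quotient. -/
theorem finite_basicCob (ha : IsRecognizable a) (hc : IsRecognizable c) (B Bl Br : Set (NCPoly K S))
    (hB : DescendsToBasis (pairSyntactic a c) B) (hBl : DescendsToBasis (leftSyntactic a) Bl)
    (hBr : DescendsToBasis (rightSyntactic a) Br) : Finite (BasicCob B Bl Br X Y) := by
  have h1 : Finite (ViewableCob X Y) :=
    Finite.of_injective ViewableCob.arcs fun x y h => ViewableCob.ext h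
  have h2 : ∀ (x : ViewableCob X Y) (p : x.arcs), Finite (allowed B Bl Br p.1) := fun x p =>
    have := finiteDimensional_quotient_arcIdeal ha hc p.1.1 p.1.2
    (allowed_descendsToBasis hB hBl hBr p.1 fun h => x.viewable (h ▸ p.2)).finite
  exact inferInstanceAs (Finite (Σ x : ViewableCob X Y, ∀ p : x.arcs, allowed B Bl Br p.1))

end Spanning

theorem mainTheorem4 {K : Type*} [Field K] {S : Type*} [Finite S]
    (a c : FreeMonoid S → K) (ha : IsRecognizable a) (hc : IsRecognizable c)
    (hsymm : IsSymmetricSeries c) (B Bl Br : Set (NCPoly K S))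
    (hB : DescendsToBasis (pairSyntactic a c) B)
    (hBl : DescendsToBasis (leftSyntactic a) Bl)
    (hBr : DescendsToBasis (rightSyntactic a) Br) (X Y : SignSeq) :
    Finite (BasicCob B Bl Br X Y) ∧
      LinearIndependent K
        (fun x : BasicCob B Bl Br X Y => (x.toSkeinHom a c : SkeinHom a c X Y)) ∧
      Submodule.span K
        (Set.range fun x : BasicCob B Bl Br X Y => (x.toSkeinHom a c : SkeinHom a c X Y)) = ⊤ ∧
      FiniteDimensional K (SkeinHom a c X Y) := by
  have hfin : Finite (BasicCob B Bl Br X Y) := finite_basicCob ha hc B Bl Br hB hBl hBr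
  have hspan := span_toSkeinHom (X := X) (Y := Y) B Bl Br hB hBl hBr
  exact ⟨hfin, linearIndependent_toSkeinHom a c hsymm B Bl Br hB hBl hBr, hspan,
    ⟨Submodule.fg_def.2 ⟨_, Set.finite_range _, hspan⟩⟩⟩
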